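/- **Proposition (existence).** Let $n\ge 1$, $s,\alpha\in(0,1)$. For $\lambda,\Lambda>0$ let $\mathcal A(\alpha,\lambda,\Lambda)$ be the class of functions $A:\mathbb R^n\times\mathbb R^n\to\mathbb R$ with $A(x,y)=A(y,x)$, $\inf_{x\in\mathbb R^n}A(x,x)>\lambda$, $\|A\|_{L^\infty}\le 1/\lambda$ and $$\sup_{z\in\mathbb R^n}|A(z,x)-A(z,y)|\le\Lambda|x-y|^\alpha\quad\text{for all }x,y\in\mathbb R^n.$$ Let $H^s(\mathbb R^n,\mathbb R^n)$ be the space of $v\in L^2(\mathbb R^n,\mathbb R^n)$ with $\iint\frac{|v(y)-v(x)|^2}{|x-y|^{n+2s}}\,dy\,dx<\infty$, with its usual norm, and let $H^{-s}(\mathbb R^n,\mathbb R^n)$ be its dual. For $u,v\in H^s(\mathbb R^n,\mathbb R^n)$ put $$\langle\mathcal L^s_Au,v\rangle=\int_{\mathbb R^n}\int_{\mathbb R^n}\frac{A(x,y)}{|x-y|^{n+2s}}\Big((u(y)-u(x))\cdot\frac{y-x}{|y-x|}\Big)\Big((v(y)-v(x))\cdot\frac{y-x}{|y-x|}\Big)dy\,dx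 .$$ Let $\Omega\subset\mathbb R^n$ be a bounded open set with Lipschitz boundary and let $V=\{v\in H^s(\mathbb R^n,\mathbb R^n): v=0 \text{ a.e. in }\mathbb R^n\setminus\Omega\}$. Then for every $\lambda>0$ there is a constant $C=C(n,\Omega,\alpha,s,\lambda)>0$, which can be chosen independent of $\lambda$ if $\alpha<2s$, such that the following holds. If $\Lambda>0$, $\lambda/\Lambda>C$, $A\in\mathcal A(\alpha,\lambda,\Lambda)$ and $f\in H^{-s}(\mathbb R^n,\mathbb R^n)$, then there is $u\in V$ with $\mathcal L^s_Au=f$ in $\Omega$, that is, $$\langle\mathcal L^s_Au,\varphi\rangle=\langle f,\varphi\rangle\quad\text{for all }\varphi\in C_c^\infty(\Omega,\mathbb R^n),$$ and this $u$ minimizes the energy $E_A(v)=\tfrac12\langle\mathcal L^s_Av,v\rangle-\langle f,v\rangle$ over $V$. -/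

import Mathlib

open MeasureTheory Set
open scoped ContDiff RealInnerProductSpace

noncomputable section

namespace Peridynamic

/-- Euclidean space `ℝⁿ`. -/
abbrev Eu (n : ℕ) : Type := EuclideanSpace ℝ (Fin n)

/-- `Ω` has Lipschitz boundary: near every boundary point, `Ω` is the strict epigraph, in some
direction `e`, of a Lipschitz function of the component `x - ⟪e, x⟫ e` orthogonal to `e`. -/
def HasLipschitzBoundary {n : ℕ} (Ω : Set (Eu n)) : Prop :=
  ∀ x₀ ∈ frontier Ω, ∃ (e : Eu n) (γ : Eu n → ℝ) (K : NNReal) (r : ℝ),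
    ‖e‖ = 1 ∧ LipschitzWith K γ ∧ 0 < r ∧
      Ω ∩ Metric.ball x₀ r = {x | γ (x - ⟪e, x⟫ • e) < ⟪e, x⟫} ∩ Metric.ball x₀ r

/-- The coefficient class `𝒜(α, λ, Λ)`. -/
structure CoeffClass {n : ℕ} (α lam Lam : ℝ) (A : Eu n → Eu n → ℝ) : Prop where
  symm : ∀ x y, A x y = A y x
  lt_iInf_diag : lam < ⨅ x, A x x
  bound : eLpNorm (fun p : Eu n × Eu n => A p.1 p.2) (⊤ : ENNReal) volume ≤ ENNReal.ofReal (1 / lam)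
  holder : ∀ z x y, |A z x - A z y| ≤ Lam * ‖x - y‖ ^ α

/-- The fractional difference quotient `(v(y) - v(x)) / |x - y| ^ (n/2 + s)`. -/
def diffQuot {n : ℕ} (s : ℝ) (v : Eu n → Eu n) (p : Eu n × Eu n) : Eu n :=
  (‖p.1 - p.2‖ ^ ((n : ℝ) / 2 + s))⁻¹ • (v p.2 - v p.1)

theorem diffQuot_congr_ae {n : ℕ} (s : ℝ) {v w : Eu n → Eu n} (h : v =ᵐ[volume] w) :
    diffQuot s v =ᵐ[volume] diffQuot s w := by
  have h1 := (Measure.quasiMeasurePreserving_fst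
    (μ := (volume : Measure (Eu n))) (ν := (volume : Measure (Eu n)))).ae_eq_comp h
  have h2 := (Measure.quasiMeasurePreserving_snd
    (μ := (volume : Measure (Eu n))) (ν := (volume : Measure (Eu n)))).ae_eq_comp h
  filter_upwards [h1, h2] with p h1 h2
  simp only [Function.comp] at h1 h2
  simp [diffQuot, h1, h2]

/-- The Sobolev space `Hˢ(ℝⁿ, ℝⁿ)`, `0 < s < 1`: the fields `v ∈ L²` whose Gagliardo seminorm
`(∬ |v(y) - v(x)|² / |x - y| ^ (n + 2s) dy dx) ^ (1/2)`, that is, the `L²(ℝⁿ × ℝⁿ)` norm of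
`diffQuot s v`, is finite. -/
def Sobolev (n : ℕ) (s : ℝ) : Submodule ℝ (Lp (Eu n) 2 (volume : Measure (Eu n))) where
  carrier := {v | MemLp (diffQuot s v) 2 (volume : Measure (Eu n × Eu n))}
  zero_mem' := by
    have h : diffQuot (n := n) s (fun _ => 0) = fun _ => 0 := by ext1; simp [diffQuot]
    have h0 := diffQuot_congr_ae s (Lp.coeFn_zero (Eu n) 2 (volume : Measure (Eu n)))
    refine (memLp_congr_ae h0).2 ?_
    change MemLp (diffQuot s (fun _ => 0)) 2 _
    rw [h]
    exact MemLp.zero'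
  add_mem' := by
    intro u v hu hv
    refine (memLp_congr_ae (diffQuot_congr_ae s (Lp.coeFn_add u v))).2 ?_
    have h : diffQuot s ((u : Eu n → Eu n) + (v : Eu n → Eu n)) = diffQuot s u + diffQuot s v := by
      ext1 p
      simp only [diffQuot, Pi.add_apply, ← smul_add]
      congr 1
      abel
    rw [h]
    exact hu.add hv
  smul_mem' := by
    intro c u hu
    refine (memLp_congr_ae (diffQuot_congr_ae s (Lp.coeFn_smul c u))).2 ?_
    have h : diffQuot s (c • (u : Eu n → Eu n)) = c • diffQuot s u := by
      ext1 p
      simp only [diffQuot, Pi.smul_apply, ← smul_sub]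
      rw [smul_comm]
    rw [h]
    exact hu.const_smul c

/-- The underlying vector field of an element of `Hˢ(ℝⁿ, ℝⁿ)`. -/
def field {n : ℕ} {s : ℝ} (v : Sobolev n s) : Eu n → Eu n :=
  ((v : Lp (Eu n) 2 (volume : Measure (Eu n))) : Eu n → Eu n)

/-- The norm of `Hˢ(ℝⁿ, ℝⁿ)`: `‖v‖² = ∫ |v|² + ∬ |v(y) - v(x)|² / |x - y| ^ (n + 2s)`. -/
def sobolevNorm {n : ℕ} {s : ℝ} (v : Sobolev n s) : ℝ :=
  Real.sqrt ((∫ x, ‖field v x‖ ^ 2) + ∫ p : Eu n × Eu n, ‖diffQuot s (field v) p‖ ^ 2)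

/-- `H⁻ˢ(ℝⁿ, ℝⁿ)`, the dual of `Hˢ(ℝⁿ, ℝⁿ)`: linear functionals bounded for the `Hˢ` norm. -/
def NegSobolev (n : ℕ) (s : ℝ) : Submodule ℝ (Sobolev n s →ₗ[ℝ] ℝ) where
  carrier := {f | ∃ C : ℝ, ∀ v, |f v| ≤ C * sobolevNorm v}
  zero_mem' := ⟨0, fun v => by simp⟩
  add_mem' := by
    rintro f g ⟨C, hC⟩ ⟨D, hD⟩
    refine ⟨C + D, fun v => ?_⟩
    rw [LinearMap.add_apply, add_mul]
    exact (abs_add_le _ _).trans (add_le_add (hC v) (hD v))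
  smul_mem' := by
    rintro c f ⟨C, hC⟩
    refine ⟨|c| * C, fun v => ?_⟩
    rw [LinearMap.smul_apply, smul_eq_mul, abs_mul, mul_assoc]
    exact mul_le_mul_of_nonneg_left (hC v) (abs_nonneg c)

/-- A radial kernel that dominates the difference quotients of a test function. -/
theorem integrable_kernel {n : ℕ} (hn : n ≠ 0) {s : ℝ} (hs : s ∈ Ioo (0 : ℝ) 1) (a b : ℝ) :
    Integrable (fun h : Eu n => if ‖h‖ ≤ 1 then a * ‖h‖ ^ (2 - (n : ℝ) - 2 * s)
      else b * ‖h‖ ^ (-(n : ℝ) - 2 * s)) volume := by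
  have : Nonempty (Fin n) := ⟨⟨0, Nat.pos_of_ne_zero hn⟩⟩
  have hn1 : 1 ≤ n := Nat.one_le_iff_ne_zero.2 hn
  rw [integrable_fun_norm_addHaar (volume : Measure (Eu n))
    (f := fun r : ℝ => if r ≤ 1 then a * r ^ (2 - (n : ℝ) - 2 * s)
      else b * r ^ (-(n : ℝ) - 2 * s))]
  rw [← Ioc_union_Ioi_eq_Ioi (zero_le_one' ℝ), integrableOn_union]
  have hpow : ∀ r : ℝ, 0 < r → ∀ t : ℝ, r ^ (n - 1) * r ^ t = r ^ ((n : ℝ) - 1 + t) := by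
    intro r hr t
    rw [Real.rpow_add hr, ← Real.rpow_natCast, Nat.cast_sub hn1, Nat.cast_one]
  constructor
  · have h1 : IntegrableOn (fun r : ℝ => a * r ^ (1 - 2 * s)) (Ioc 0 1) := by
      refine Integrable.const_mul ?_ _
      have := intervalIntegral.intervalIntegrable_rpow' (a := 0) (b := 1) (r := 1 - 2 * s)
        (by linarith [hs.2])
      rwa [intervalIntegrable_iff_integrableOn_Ioc_of_le zero_le_one] at this
    refine h1.congr_fun (fun r hr => ?_) measurableSet_Ioc
    simp only [finrank_euclideanSpace, Fintype.card_fin, smul_eq_mul, if_pos hr.2]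
    rw [mul_left_comm, hpow r hr.1]
    ring_nf
  · have h1 : IntegrableOn (fun r : ℝ => b * r ^ (-1 - 2 * s)) (Ioi 1) :=
      Integrable.const_mul (integrableOn_Ioi_rpow_of_lt (by linarith [hs.1]) one_pos) _
    refine h1.congr_fun (fun r hr => ?_) measurableSet_Ioi
    have hr1 : (1 : ℝ) < r := hr
    simp only [finrank_euclideanSpace, Fintype.card_fin, smul_eq_mul, if_neg (not_le.2 hr1)]
    rw [mul_left_comm, hpow r (by linarith)]
    ring_nf

/-- Test functions have finite Gagliardo seminorm. -/
theorem memLp_diffQuot_of_test {n : ℕ} {s : ℝ} (hs : s ∈ Ioo (0 : ℝ) 1) {φ : Eu n → Eu n}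
    (hφ : ContDiff ℝ ∞ φ) (hc : HasCompactSupport φ) :
    MemLp (diffQuot s φ) 2 (volume : Measure (Eu n × Eu n)) := by
  rcases eq_or_ne n 0 with rfl | hn
  · have h : diffQuot s φ = fun _ => 0 := by ext1 p; exact Subsingleton.elim _ _
    rw [h]
    exact MemLp.zero'
  obtain ⟨L, hL⟩ := (hφ.lipschitzWith_of_hasCompactSupport hc (by simp))
  obtain ⟨M, hM⟩ := hc.exists_bound_of_continuous hφ.continuous
  have hmeas : AEStronglyMeasurable (diffQuot s φ) (volume : Measure (Eu n × Eu n)) := by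
    have h1 : Measurable fun p : Eu n × Eu n => (‖p.1 - p.2‖ ^ ((n : ℝ) / 2 + s))⁻¹ := by fun_prop
    have h2 : Continuous fun p : Eu n × Eu n => φ p.2 - φ p.1 := by
      have := hφ.continuous
      fun_prop
    exact h1.aestronglyMeasurable.smul h2.aestronglyMeasurable
  rw [memLp_two_iff_integrable_sq_norm hmeas]
  set g : Eu n → ℝ := fun h => if ‖h‖ ≤ 1 then (L : ℝ) ^ 2 * ‖h‖ ^ (2 - (n : ℝ) - 2 * s)
      else (2 * M) ^ 2 * ‖h‖ ^ (-(n : ℝ) - 2 * s) with hg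
  have hgi : Integrable g := integrable_kernel hn hs _ _
  have hg0 : ∀ h, 0 ≤ g h := by
    intro h
    simp only [hg]
    split_ifs <;> positivity
  set k : Eu n → ℝ := (tsupport φ).indicator fun _ => 1 with hk
  have hk0 : ∀ x, 0 ≤ k x := fun x => indicator_nonneg (fun _ _ => zero_le_one) x
  have hki : Integrable k :=
    (integrable_indicator_iff hc.isCompact.isClosed.measurableSet).2
      (integrableOn_const hc.isCompact.measure_lt_top.ne)
  have hI : Integrable (fun p : Eu n × Eu n => k p.2 * g (p.1 - p.2)) (volume.prod volume) := by
    simpa using hki.convolution_integrand (ContinuousLinearMap.mul ℝ ℝ) hgi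
  have hI' : Integrable (fun p : Eu n × Eu n => k p.1 * g (p.2 - p.1)) (volume.prod volume) := by
    simpa [Function.comp_def] using hI.swap
  have hsum := hI.add hI'
  refine Integrable.mono' (g := fun p : Eu n × Eu n =>
    k p.2 * g (p.1 - p.2) + k p.1 * g (p.2 - p.1)) hsum (hmeas.norm.pow 2)
    (Filter.Eventually.of_forall ?_)
  rintro ⟨x, y⟩
  have hgs : g (y - x) = g (x - y) := by simp only [hg, norm_sub_rev]
  simp only [hgs, Real.norm_eq_abs, abs_pow, abs_norm]
  by_cases hxy : φ y - φ x = 0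
  · simp only [diffQuot, hxy, smul_zero, norm_zero]
    have := mul_nonneg (hk0 y) (hg0 (x - y))
    have := mul_nonneg (hk0 x) (hg0 (x - y))
    norm_num
    linarith
  have hk1 : 1 ≤ k y + k x := by
    by_cases hy : φ y = 0
    · have hx : x ∈ tsupport φ := subset_tsupport φ (by
        intro hx
        exact hxy (by rw [hx, hy, sub_zero]))
      have : k x = 1 := by simp [hk, hx]
      linarith [hk0 y]
    · have : k y = 1 := by simp [hk, subset_tsupport φ hy]
      linarith [hk0 x]
  have hpos : 0 < ‖x - y‖ := by
    rw [norm_pos_iff, sub_ne_zero]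
    rintro rfl
    exact hxy (sub_self _)
  have hker : ((‖x - y‖ ^ ((n : ℝ) / 2 + s))⁻¹) ^ 2 = ‖x - y‖ ^ (-(n : ℝ) - 2 * s) := by
    rw [← Real.rpow_neg hpos.le, ← Real.rpow_natCast, ← Real.rpow_mul hpos.le]
    congr 1
    push_cast
    ring
  have hmain : ‖diffQuot s φ (x, y)‖ ^ 2 ≤ g (x - y) := by
    simp only [diffQuot, norm_smul, mul_pow, norm_inv, Real.norm_eq_abs,
      abs_of_nonneg (Real.rpow_nonneg hpos.le _), hker]
    simp only [hg]
    split_ifs with h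
    · have h1 : ‖φ y - φ x‖ ≤ L * ‖x - y‖ := by
        have := hL.norm_sub_le y x
        rwa [norm_sub_rev y x] at this
      have h2 : ‖x - y‖ ^ (2 - (n : ℝ) - 2 * s)
          = ‖x - y‖ ^ (-(n : ℝ) - 2 * s) * ‖x - y‖ ^ 2 := by
        rw [← Real.rpow_natCast, ← Real.rpow_add hpos]
        congr 1
        push_cast
        ring
      calc _ ≤ ‖x - y‖ ^ (-(n : ℝ) - 2 * s) * (L * ‖x - y‖) ^ 2 := by gcongr
        _ = _ := by rw [h2]; ring
    · have h1 : ‖φ y - φ x‖ ≤ 2 * M := by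
        have := norm_sub_le (φ y) (φ x)
        linarith [hM x, hM y]
      calc _ ≤ ‖x - y‖ ^ (-(n : ℝ) - 2 * s) * (2 * M) ^ 2 := by gcongr
        _ = _ := by ring
  calc _ ≤ g (x - y) := hmain
    _ ≤ (k y + k x) * g (x - y) := le_mul_of_one_le_left (hg0 _) hk1
    _ = _ := by ring

/-- A test function `φ ∈ C_c^∞(ℝⁿ, ℝⁿ)`, seen as an element of `Hˢ(ℝⁿ, ℝⁿ)`. -/
def Sobolev.ofTest {n : ℕ} {s : ℝ} (hs : s ∈ Ioo (0 : ℝ) 1) (φ : Eu n → Eu n)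
    (hφ : ContDiff ℝ ∞ φ) (hc : HasCompactSupport φ) : Sobolev n s :=
  ⟨(hφ.continuous.memLp_of_hasCompactSupport hc).toLp φ,
    (memLp_congr_ae (diffQuot_congr_ae s (MemLp.coeFn_toLp _))).2
      (memLp_diffQuot_of_test hs hφ hc)⟩

/-- The pairing `⟨ℒˢ_A u, v⟩`, that is,
`∫∫ A(x,y) / |x-y|^(n+2s) ((u(y)-u(x)) · (y-x)/|y-x|) ((v(y)-v(x)) · (y-x)/|y-x|) dy dx`. -/
def pairing {n : ℕ} (s : ℝ) (A : Eu n → Eu n → ℝ) (u v : Eu n → Eu n) : ℝ :=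
  ∫ x, ∫ y, A x y / ‖x - y‖ ^ ((n : ℝ) + 2 * s) *
    ⟪u y - u x, ‖y - x‖⁻¹ • (y - x)⟫ * ⟪v y - v x, ‖y - x‖⁻¹ • (y - x)⟫

/-- The space of all `v ∈ Hˢ(ℝⁿ, ℝⁿ)` with `v = 0` (almost everywhere) on `ℝⁿ ∖ Ω`. -/
def vanishingOutside {n : ℕ} (s : ℝ) (Ω : Set (Eu n)) : Set (Sobolev n s) :=
  {v | ∀ᵐ x, x ∉ Ω → field v x = 0}

/-- `ℒˢ_A u = f` in `Ω`: `⟨ℒˢ_A u, φ⟩ = ⟨f, φ⟩` for all `φ ∈ C_c^∞(Ω, ℝⁿ)`. -/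
def IsSolution {n : ℕ} {s : ℝ} (hs : s ∈ Ioo (0 : ℝ) 1) (Ω : Set (Eu n)) (A : Eu n → Eu n → ℝ)
    (f : NegSobolev n s) (u : Sobolev n s) : Prop :=
  ∀ (φ : Eu n → Eu n) (hφ : ContDiff ℝ ∞ φ) (hc : HasCompactSupport φ), tsupport φ ⊆ Ω →
    pairing s A (field u) φ = f.1 (Sobolev.ofTest hs φ hφ hc)

/-- The energy `E_A(v) = ½ ⟨ℒˢ_A v, v⟩ - ⟨f, v⟩`. -/
def energy {n : ℕ} {s : ℝ} (A : Eu n → Eu n → ℝ) (f : NegSobolev n s) (v : Sobolev n s) : ℝ :=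
  1 / 2 * pairing s A (field v) (field v) - f.1 v

end Peridynamic

end

/-!
Existence is the Lax–Milgram theorem on the space `V` of fields in `Hˢ(ℝⁿ, ℝⁿ)` vanishing outside
`Ω`; as the form is symmetric, its solution minimizes the energy. The whole matter is coercivity of
the form on `V`: only the longitudinal part `(v(y) - v(x)) · (y - x) / |y - x|` of the differences
enters, and `A` may be negative away from the diagonal.

*Korn inequality* (`exists_korn`). With `D_h v = v(· + h) - v`, expanding
`D_{h+k} v · (h + k)` shows that `D_h v · k + (D_k v · h)(· + h)` is a combination of longitudinal
differences, and applying `D_h` to it turns its second term into one as well. Hence each component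
`D_h² v · k` is a combination of longitudinal differences with steps `h`, `k`, `h + k`
(`lintegral_second_diff_inner_le`). Taking `k = T h` for invertible linear maps `T` that span all
matrices, and integrating in `h` against a homogeneous kernel, one controls the Gagliardo seminorm
built with second differences (`exists_lintegral_second_diff_le`). Finally
`2 D_h v = D_{2h} v - D_h² v`, and dilation by `2` multiplies the Gagliardo seminorm by `2 ^ s < 2`,
so that the first term on the right is absorbed.

*Poincaré inequality* (`exists_poincare`). A ball outside `Ω` at bounded distance from the points of
`Ω` bounds the `L²` norm of `v` by its Gagliardo seminorm.

*Coercivity* (`exists_coercive_threshold`). By the Hölder condition `A(x, y) ≥ λ - Λ |x - y| ^ α`.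
If `α < 2 s`, the kernel `|h| ^ (α - n - 2 s)` is integrable at infinity, so the negative part of
this bound costs at most `C Λ` times the longitudinal energy, by the two inequalities above. In
general, the bound is used for `|x - y| ≤ r` only, and `A ≥ -1/λ` beyond, where the kernel has small
integral if `r` is large in terms of `λ`; the threshold is then `4 r ^ α`.
-/

namespace Peridynamic

open scoped ENNReal

variable {n : ℕ}

/-! ### Longitudinal and second differences -/

/-- Fubini in the variables `x` and `h = y - x`. -/
theorem lintegral_prod_eq_shift {f : Eu n × Eu n → ℝ≥0∞} (hf : Measurable f) :
    ∫⁻ p, f p = ∫⁻ h, ∫⁻ x, f (x, x + h) := by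
  rw [Measure.volume_eq_prod, lintegral_prod _ hf.aemeasurable]
  have h1 : ∀ x, ∫⁻ y, f (x, y) = ∫⁻ h, f (x, x + h) := fun x =>
    (lintegral_add_left_eq_self (fun y => f (x, y)) x).symm
  simp_rw [h1]
  exact lintegral_lintegral_swap (f := fun x h => f (x, x + h)) (by fun_prop)

/-- The squared `L²` norm of `x ↦ (v (x + h) - v x) · h`. -/
noncomputable def strain (v : Eu n → Eu n) (h : Eu n) : ℝ≥0∞ :=
  ∫⁻ x, ENNReal.ofReal (⟪v (x + h) - v x, h⟫ ^ 2)

theorem measurable_strain {v : Eu n → Eu n} (hv : Measurable v) : Measurable (strain v) := by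
  unfold strain
  exact Measurable.lintegral_prod_right'
    (f := fun p : Eu n × Eu n => ENNReal.ofReal (⟪v (p.2 + p.1) - v p.2, p.1⟫ ^ 2)) (by fun_prop)

/-- Translation invariance of the integral that defines `strain`. -/
theorem strain_shift {v : Eu n → Eu n} (h a : Eu n) :
    ∫⁻ x, ENNReal.ofReal (⟪v (x + a + h) - v (x + a), h⟫ ^ 2) = strain v h :=
  lintegral_add_right_eq_self (fun x => ENNReal.ofReal (⟪v (x + h) - v x, h⟫ ^ 2)) a

/-- Every component of a second difference is a combination of longitudinal first differences:
with `a = D_{h+k} v · (h+k)`, `b = D_h v · h` and `c = D_k v · k` one has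
`D_h² v · k = a(x+h) - a(x) + b(x) - b(x+h+k) + c(x+h) - c(x+2h)`. -/
theorem lintegral_second_diff_inner_le {v : Eu n → Eu n} (hv : Measurable v) (h k : Eu n) :
    ∫⁻ x, ENNReal.ofReal (⟪v (x + h + h) - v (x + h) - (v (x + h) - v x), k⟫ ^ 2) ≤
      12 * (strain v (h + k) + strain v h + strain v k) := by
  set a : Eu n → ℝ := fun x => ⟪v (x + (h + k)) - v x, h + k⟫ with ha
  set b : Eu n → ℝ := fun x => ⟪v (x + h) - v x, h⟫ with hb
  set c : Eu n → ℝ := fun x => ⟪v (x + k) - v x, k⟫ with hc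
  have ham : Measurable a := by simp only [ha]; fun_prop
  have hbm : Measurable b := by simp only [hb]; fun_prop
  have hcm : Measurable c := by simp only [hc]; fun_prop
  have hid : ∀ x, ⟪v (x + h + h) - v (x + h) - (v (x + h) - v x), k⟫ =
      a (x + h) - a x + b x - c (x + (h + h)) + c (x + h) - b (x + (h + k)) := by
    intro x
    have e1 : x + h + (h + k) = x + h + h + k := by abel
    have e2 : x + h + k + h = x + h + h + k := by abel
    have e3 : x + (h + h) = x + h + h := by abel
    have e4 : x + (h + k) = x + h + k := by abel
    simp only [ha, hb, hc, e1, e3, e4, e2, inner_sub_left, inner_add_right]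
    ring
  have hpt : ∀ x, ENNReal.ofReal (⟪v (x + h + h) - v (x + h) - (v (x + h) - v x), k⟫ ^ 2) ≤
      6 * (ENNReal.ofReal (a (x + h) ^ 2) + ENNReal.ofReal (a x ^ 2) + ENNReal.ofReal (b x ^ 2)
        + ENNReal.ofReal (c (x + (h + h)) ^ 2) + ENNReal.ofReal (c (x + h) ^ 2)
        + ENNReal.ofReal (b (x + (h + k)) ^ 2)) := by
    intro x
    rw [hid]
    generalize a (x + h) = y1
    generalize a x = y2
    generalize b x = y3
    generalize c (x + (h + h)) = y4
    generalize c (x + h) = y5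
    generalize b (x + (h + k)) = y6
    have h6 : (6 : ℝ≥0∞) = ENNReal.ofReal 6 := by simp
    rw [h6, ← ENNReal.ofReal_add (by positivity) (by positivity),
      ← ENNReal.ofReal_add (by positivity) (by positivity),
      ← ENNReal.ofReal_add (by positivity) (by positivity),
      ← ENNReal.ofReal_add (by positivity) (by positivity),
      ← ENNReal.ofReal_add (by positivity) (by positivity),
      ← ENNReal.ofReal_mul (by norm_num)]
    apply ENNReal.ofReal_le_ofReal
    have := sq_sum_le_card_mul_sum_sq (s := (Finset.univ : Finset (Fin 6)))
      (f := ![y1, -y2, y3, -y4, y5, -y6])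
    simp [Fin.sum_univ_succ] at this
    nlinarith [this]
  refine (lintegral_mono hpt).trans ?_
  rw [lintegral_const_mul _ (by fun_prop), lintegral_add_right _ (by fun_prop),
    lintegral_add_right _ (by fun_prop), lintegral_add_right _ (by fun_prop),
    lintegral_add_right _ (by fun_prop), lintegral_add_right _ (by fun_prop)]
  have e1 : ∀ y, ∫⁻ x, ENNReal.ofReal (a (x + y) ^ 2) = strain v (h + k) := fun y =>
    strain_shift (h + k) y
  have e2 : ∀ y, ∫⁻ x, ENNReal.ofReal (b (x + y) ^ 2) = strain v h := fun y => strain_shift h y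
  have e3 : ∀ y, ∫⁻ x, ENNReal.ofReal (c (x + y) ^ 2) = strain v k := fun y => strain_shift k y
  have e4 : ∫⁻ x, ENNReal.ofReal (a x ^ 2) = strain v (h + k) := rfl
  have e5 : ∫⁻ x, ENNReal.ofReal (b x ^ 2) = strain v h := rfl
  rw [e1, e2, e3, e3, e4, e5]
  apply le_of_eq
  ring

/-! ### Homogeneous kernels and the Korn inequality -/

/-- The homogeneous kernel `|h| ^ (-t)`; its value at `h = 0` is `0` for `t ≠ 0`. -/
noncomputable def kern (t : ℝ) (h : Eu n) : ℝ≥0∞ := ENNReal.ofReal (‖h‖ ^ (-t))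

@[fun_prop]
theorem measurable_kern (t : ℝ) : Measurable (kern (n := n) t) := by unfold kern; fun_prop

theorem kern_le_mul_kern_apply {t : ℝ} (ht : 0 < t) (T : Eu n →L[ℝ] Eu n)
    (hT : Function.Injective T) (h : Eu n) :
    kern t h ≤ ENNReal.ofReal (‖T‖ ^ t) * kern t (T h) := by
  unfold kern
  rw [← ENNReal.ofReal_mul (by positivity)]
  apply ENNReal.ofReal_le_ofReal
  rcases eq_or_ne h 0 with rfl | hh
  · simp [Real.zero_rpow (neg_ne_zero.2 ht.ne')]
  have h1 : 0 < ‖T h‖ := norm_pos_iff.2 fun h0 => hh (hT (by rw [h0, map_zero]))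
  have h2 : 0 < ‖h‖ := norm_pos_iff.2 hh
  have h3 := T.le_opNorm h
  have h4 : 0 < ‖T‖ := by
    by_contra hc
    have : ‖T‖ = 0 := le_antisymm (not_lt.1 hc) (norm_nonneg _)
    rw [this, zero_mul] at h3
    linarith
  rw [Real.rpow_neg h2.le, Real.rpow_neg h1.le, ← div_eq_mul_inv, inv_eq_one_div,
    div_le_div_iff₀ (by positivity) (by positivity), one_mul, ← Real.mul_rpow h4.le h2.le]
  exact Real.rpow_le_rpow h1.le h3 ht.le

/-- Change of variables by an invertible linear map, against a homogeneous kernel. -/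
theorem lintegral_kern_comp_le {t : ℝ} (ht : 0 < t) (T : Eu n →L[ℝ] Eu n)
    (hT : Function.Injective T) {g : Eu n → ℝ≥0∞} (hg : Measurable g) :
    ∫⁻ h, kern t h * g (T h) ≤
      ENNReal.ofReal (‖T‖ ^ t) * ENNReal.ofReal |(LinearMap.det (T : Eu n →ₗ[ℝ] Eu n))⁻¹| *
        ∫⁻ h, kern t h * g h := by
  have hdet : LinearMap.det (T : Eu n →ₗ[ℝ] Eu n) ≠ 0 := by
    have := (LinearEquiv.ofInjectiveEndo (T : Eu n →ₗ[ℝ] Eu n) hT).isUnit_det'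
    exact this.ne_zero
  have hcv : ∫⁻ h, kern t (T h) * g (T h) =
      ENNReal.ofReal |(LinearMap.det (T : Eu n →ₗ[ℝ] Eu n))⁻¹| * ∫⁻ h, kern t h * g h := by
    have h1 := Measure.map_linearMap_addHaar_eq_smul_addHaar (volume : Measure (Eu n)) hdet
    have h2 := lintegral_map (μ := (volume : Measure (Eu n))) (f := fun h => kern t h * g h)
      (g := T) (by fun_prop) T.continuous.measurable
    rw [← h2]
    change ∫⁻ a, kern t a * g a ∂(Measure.map (T : Eu n →ₗ[ℝ] Eu n) volume) = _
    rw [h1, lintegral_smul_measure, smul_eq_mul]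
  rw [mul_assoc, ← hcv, ← lintegral_const_mul _ (by
    have := T.continuous.measurable
    fun_prop)]
  refine lintegral_mono fun h => ?_
  rw [← mul_assoc]
  gcongr
  exact kern_le_mul_kern_apply ht T hT h

/-- The squared `L²` norm of the second difference `D_h² v`, tested against the vector `k`. -/
noncomputable def secondStrain (v : Eu n → Eu n) (h k : Eu n) : ℝ≥0∞ :=
  ∫⁻ x, ENNReal.ofReal (⟪v (x + h + h) - v (x + h) - (v (x + h) - v x), k⟫ ^ 2)

/-- Second differences in the direction `T h` are controlled by longitudinal first differences when
the three steps `h`, `T h` and `h + T h` all depend invertibly on `h`. -/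
theorem exists_lintegral_secondStrain_le {t : ℝ} (ht : 0 < t) (T : Eu n →L[ℝ] Eu n)
    (hT : Function.Injective T)
    (hT' : Function.Injective (ContinuousLinearMap.id ℝ (Eu n) + T)) :
    ∃ C : ℝ≥0∞, C ≠ ⊤ ∧ ∀ v : Eu n → Eu n, Measurable v →
      ∫⁻ h, kern t h * secondStrain v h (T h) ≤ C * ∫⁻ h, kern t h * strain v h := by
  refine ⟨12 * (ENNReal.ofReal (‖ContinuousLinearMap.id ℝ (Eu n) + T‖ ^ t) *
      ENNReal.ofReal |(LinearMap.det
        ((ContinuousLinearMap.id ℝ (Eu n) + T : Eu n →L[ℝ] Eu n) : Eu n →ₗ[ℝ] Eu n))⁻¹| + 1 +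
      ENNReal.ofReal (‖T‖ ^ t) * ENNReal.ofReal |(LinearMap.det (T : Eu n →ₗ[ℝ] Eu n))⁻¹|),
    ?_, fun v hv => ?_⟩
  · finiteness
  have hm := measurable_strain hv
  have hTm := T.continuous.measurable
  calc ∫⁻ h, kern t h * secondStrain v h (T h)
      ≤ ∫⁻ h, 12 * (kern t h * strain v ((ContinuousLinearMap.id ℝ (Eu n) + T) h) +
          kern t h * strain v h + kern t h * strain v (T h)) := by
        refine lintegral_mono fun h => ?_
        rw [← mul_add, ← mul_add, mul_left_comm]
        gcongr
        exact lintegral_second_diff_inner_le hv h (T h)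
    _ = 12 * ((∫⁻ h, kern t h * strain v ((ContinuousLinearMap.id ℝ (Eu n) + T) h)) +
          (∫⁻ h, kern t h * strain v h) + ∫⁻ h, kern t h * strain v (T h)) := by
        have hm2 := (ContinuousLinearMap.id ℝ (Eu n) + T).continuous.measurable
        rw [lintegral_const_mul _ (by fun_prop), lintegral_add_right _ (by fun_prop),
          lintegral_add_right _ (by fun_prop)]
    _ ≤ _ := by
        rw [mul_assoc, add_mul, add_mul, one_mul]
        gcongr
        · exact lintegral_kern_comp_le ht _ hT' hm
        · exact lintegral_kern_comp_le ht _ hT hm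

/-- The shear or stretch `h ↦ h + (h j / 2) e_i`. -/
noncomputable def shear (i j : Fin n) : Eu n →L[ℝ] Eu n :=
  ContinuousLinearMap.id ℝ (Eu n) +
    (EuclideanSpace.proj j : Eu n →L[ℝ] ℝ).smulRight (EuclideanSpace.single i (1 / 2 : ℝ))

theorem shear_apply (i j : Fin n) (h : Eu n) :
    shear i j h = h + h j • EuclideanSpace.single i (1 / 2 : ℝ) := by
  simp [shear]

/-- A perturbation of norm at most `1/2` leaves `c • id` injective for `c ≥ 1`. -/
theorem injective_smul_id_add {c : ℝ} (hc : 1 ≤ c) (i j : Fin n) {T : Eu n → Eu n}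
    (hT : ∀ h, T h = c • h + h j • EuclideanSpace.single i (1 / 2 : ℝ)) :
    Function.Injective T := by
  intro a b hab
  rw [hT, hT] at hab
  have h1 : c • (a - b) = -((a - b) j • EuclideanSpace.single i (1 / 2 : ℝ)) := by
    rw [PiLp.sub_apply]
    rw [← sub_eq_zero] at hab ⊢
    rw [← hab]
    module
  have h2 := congrArg norm h1
  rw [norm_neg, norm_smul, norm_smul, PiLp.norm_single, Real.norm_of_nonneg
    (by linarith : 0 ≤ c)] at h2
  have h3 := PiLp.norm_apply_le (a - b) j
  have h4 : ‖(1 / 2 : ℝ)‖ = 1 / 2 := by norm_num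
  rw [h4] at h2
  have h5 : ‖a - b‖ = 0 := by nlinarith [norm_nonneg (a - b)]
  exact sub_eq_zero.1 (norm_eq_zero.1 h5)

theorem injective_shear (i j : Fin n) : Function.Injective (shear i j) :=
  injective_smul_id_add le_rfl i j fun h => by rw [shear_apply, one_smul]

theorem injective_id_add_shear (i j : Fin n) :
    Function.Injective (ContinuousLinearMap.id ℝ (Eu n) + shear i j) :=
  injective_smul_id_add one_le_two i j fun h => by
    simp only [_root_.add_apply, ContinuousLinearMap.id_apply, shear_apply, two_smul]
    abel

/-- The directions `h` and `shear i j h` determine `w`: `w · shear i j h - w · h = w_i h_j / 2`. -/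
theorem norm_sq_mul_norm_sq_le_sum (w h : Eu n) :
    ‖w‖ ^ 2 * ‖h‖ ^ 2 ≤ ∑ i, ∑ j, 8 * (⟪w, shear i j h⟫ ^ 2 + ⟪w, h⟫ ^ 2) := by
  rw [EuclideanSpace.norm_sq_eq, EuclideanSpace.norm_sq_eq, Finset.sum_mul_sum]
  refine Finset.sum_le_sum fun i _ => Finset.sum_le_sum fun j _ => ?_
  have h1 : ⟪w, shear i j h⟫ = ⟪w, h⟫ + h j * (w i * (1 / 2)) := by
    rw [shear_apply, inner_add_right, inner_smul_right, EuclideanSpace.inner_single_right]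
    simp [mul_comm]
  rw [h1, Real.norm_eq_abs, Real.norm_eq_abs, sq_abs, sq_abs]
  nlinarith [sq_nonneg (2 * ⟪w, h⟫ + (1 / 2) * (h j * w i))]

theorem kern_eq_kern_add_two_mul {t : ℝ} (ht : 0 < t) (h : Eu n) :
    kern t h = kern (t + 2) h * ENNReal.ofReal (‖h‖ ^ 2) := by
  unfold kern
  rw [← ENNReal.ofReal_mul (by positivity)]
  congr 1
  rcases eq_or_ne h 0 with rfl | hh
  · rw [norm_zero, Real.zero_rpow (by linarith), Real.zero_rpow (by linarith), zero_mul]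
  have h2 : 0 < ‖h‖ := norm_pos_iff.2 hh
  rw [← Real.rpow_natCast, ← Real.rpow_add h2]
  congr 1
  push_cast
  ring

theorem measurable_secondStrain {v : Eu n → Eu n} (hv : Measurable v)
    (T : Eu n →L[ℝ] Eu n) : Measurable fun h => secondStrain v h (T h) := by
  unfold secondStrain
  exact Measurable.lintegral_prod_right'
    (f := fun p : Eu n × Eu n => ENNReal.ofReal
      (⟪v (p.2 + p.1 + p.1) - v (p.2 + p.1) - (v (p.2 + p.1) - v p.2), T p.1⟫ ^ 2)) (by fun_prop)

/-- The second differences of a field are controlled by its longitudinal first differences. -/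
theorem exists_lintegral_second_diff_le (n : ℕ) {t : ℝ} (ht : 0 < t) :
    ∃ C : ℝ≥0∞, C ≠ ⊤ ∧ ∀ v : Eu n → Eu n, Measurable v →
      ∫⁻ h, kern t h * ∫⁻ x, ENNReal.ofReal
          (‖v (x + h + h) - v (x + h) - (v (x + h) - v x)‖ ^ 2) ≤
        C * ∫⁻ h, kern (t + 2) h * strain v h := by
  have ht2 : 0 < t + 2 := by linarith
  choose C hC hCv using fun i j : Fin n => exists_lintegral_secondStrain_le ht2 (shear i j)
    (injective_shear i j) (injective_id_add_shear i j)
  -- `T = id` controls the component of `D_h² v` along `h` itself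
  obtain ⟨D, hD, hDv⟩ := exists_lintegral_secondStrain_le (n := n) ht2
    (ContinuousLinearMap.id ℝ (Eu n)) (fun _ _ h => h) (fun a b h => by
      have h' : a + a = b + b := h
      rw [← two_smul ℝ a, ← two_smul ℝ b] at h'
      exact smul_right_injective _ (two_ne_zero (α := ℝ)) h')
  refine ⟨∑ i, ∑ j, 8 * (C i j + D), ?_, fun v hv => ?_⟩
  · refine ENNReal.sum_ne_top.2 fun i _ => ENNReal.sum_ne_top.2 fun j _ => ?_
    have := hC i j
    finiteness
  have hpt : ∀ h, kern t h * ∫⁻ x, ENNReal.ofReal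
      (‖v (x + h + h) - v (x + h) - (v (x + h) - v x)‖ ^ 2) ≤
      ∑ i, ∑ j, 8 * (kern (t + 2) h * secondStrain v h (shear i j h) +
        kern (t + 2) h * secondStrain v h (ContinuousLinearMap.id ℝ (Eu n) h)) := by
    intro h
    rw [kern_eq_kern_add_two_mul ht, mul_assoc, ← lintegral_const_mul _ (by fun_prop)]
    simp_rw [← mul_add, mul_left_comm (8 : ℝ≥0∞), ← Finset.mul_sum _ _ (kern (t + 2) h)]
    gcongr
    unfold secondStrain
    calc _ ≤ ∫⁻ x, ∑ i, ∑ j, 8 * (ENNReal.ofReal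
            (⟪v (x + h + h) - v (x + h) - (v (x + h) - v x), shear i j h⟫ ^ 2) + ENNReal.ofReal
            (⟪v (x + h + h) - v (x + h) - (v (x + h) - v x), h⟫ ^ 2)) := by
          refine lintegral_mono fun x => ?_
          rw [← ENNReal.ofReal_mul (by positivity), mul_comm]
          refine (ENNReal.ofReal_le_ofReal (norm_sq_mul_norm_sq_le_sum _ _)).trans_eq ?_
          rw [ENNReal.ofReal_sum_of_nonneg
            fun i _ => Finset.sum_nonneg fun j _ => by positivity]
          refine Finset.sum_congr rfl fun i _ => ?_
          rw [ENNReal.ofReal_sum_of_nonneg fun j _ => by positivity]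
          refine Finset.sum_congr rfl fun j _ => ?_
          rw [ENNReal.ofReal_mul (by norm_num), ENNReal.ofReal_add (by positivity) (by positivity)]
          simp
      _ = _ := by
          rw [lintegral_finsetSum _ (fun i _ => by fun_prop)]
          refine Finset.sum_congr rfl fun i _ => ?_
          rw [lintegral_finsetSum _ (fun i _ => by fun_prop)]
          refine Finset.sum_congr rfl fun j _ => ?_
          rw [lintegral_const_mul _ (by fun_prop), lintegral_add_right _ (by fun_prop)]
          rfl
  refine (lintegral_mono hpt).trans ?_
  have hmi := measurable_secondStrain hv (ContinuousLinearMap.id ℝ (Eu n))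
  have hms : ∀ i j, Measurable fun h => secondStrain v h (shear i j h) := fun i j =>
    measurable_secondStrain hv (shear i j)
  have hmij : ∀ i j, Measurable fun h => 8 * (kern (t + 2) h * secondStrain v h (shear i j h) +
        kern (t + 2) h * secondStrain v h (ContinuousLinearMap.id ℝ (Eu n) h)) := by
    intro i j
    have := hms i j
    fun_prop
  rw [lintegral_finsetSum _ (fun i _ => Finset.measurable_sum _ fun j _ => hmij i j),
    Finset.sum_mul]
  refine Finset.sum_le_sum fun i _ => ?_
  rw [lintegral_finsetSum _ (fun j _ => hmij i j), Finset.sum_mul]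
  refine Finset.sum_le_sum fun j _ => ?_
  have := hms i j
  rw [lintegral_const_mul _ (by fun_prop), lintegral_add_right _ (by fun_prop), mul_assoc, add_mul]
  gcongr
  · exact hCv i j v hv
  · exact hDv v hv

/-- The weight `2 ^ (1 - s) > 1` in Young's inequality is chosen so that, after the factor
`2 ^ (2 s)` from the dilation, the coefficient of the term in `b` is `2 ^ (s - 1) < 1`. -/
theorem norm_sq_le_of_eq_half_sub {s : ℝ} (hs : s < 1) {a b c : Eu n} (h : (2 : ℝ) • a = b - c) :
    ‖a‖ ^ 2 ≤ 2 ^ (1 - s) / 4 * ‖b‖ ^ 2 +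
      (1 + (2 ^ (1 - s) - 1)⁻¹) / 4 * ‖c‖ ^ 2 := by
  have h1 : (1 : ℝ) < 2 ^ (1 - s) := Real.one_lt_rpow one_lt_two (by linarith)
  obtain ⟨e, he⟩ : ∃ e : ℝ, 2 ^ (1 - s) = 1 + e := ⟨2 ^ (1 - s) - 1, by ring⟩
  rw [he] at h1 ⊢
  have he0 : 0 < e := by linarith
  have h2 : 2 * ‖a‖ ≤ ‖b‖ + ‖c‖ := by
    have := norm_sub_le b c
    rwa [← h, norm_smul, Real.norm_two] at this
  have h3 : 4 * ‖a‖ ^ 2 ≤ (‖b‖ + ‖c‖) ^ 2 := by nlinarith [norm_nonneg a]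
  have h4 : (‖b‖ + ‖c‖) ^ 2 ≤ (1 + e) * ‖b‖ ^ 2 + (1 + e⁻¹) * ‖c‖ ^ 2 := by
    have h5 : 0 ≤ e * (‖b‖ - e⁻¹ * ‖c‖) ^ 2 := by positivity
    have h6 : e * (‖b‖ - e⁻¹ * ‖c‖) ^ 2 =
        e * ‖b‖ ^ 2 - 2 * ‖b‖ * ‖c‖ + e⁻¹ * ‖c‖ ^ 2 := by
      field_simp
      ring
    nlinarith
  have h7 : 1 + e - 1 = e := by ring
  rw [h7]
  linarith

/-- Fractional Korn inequality on `ℝⁿ`: the Gagliardo seminorm, if finite, is controlled by the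
longitudinal differences. Since `2 D_h v = D_{2h} v - D_h² v` and the dilation `h ↦ 2h` multiplies
the seminorm by `2 ^ s < 2`, the seminorm is controlled by second differences. -/
theorem exists_korn (n : ℕ) {s : ℝ} (hs : s ∈ Ioo (0 : ℝ) 1) :
    ∃ C : ℝ≥0∞, C ≠ ⊤ ∧ ∀ v : Eu n → Eu n, Measurable v →
      (∫⁻ h, kern (n + 2 * s) h * ∫⁻ x, ENNReal.ofReal (‖v (x + h) - v x‖ ^ 2)) ≠ ⊤ →
      ∫⁻ h, kern (n + 2 * s) h * ∫⁻ x, ENNReal.ofReal (‖v (x + h) - v x‖ ^ 2) ≤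
        C * ∫⁻ h, kern (n + 2 * s + 2) h * strain v h := by
  obtain ⟨hs0, hs1⟩ := hs
  have ht : 0 < (n : ℝ) + 2 * s := by positivity
  obtain ⟨C, hC, hCv⟩ := exists_lintegral_second_diff_le n ht
  set K : ℝ := (1 + (2 ^ (1 - s) - 1)⁻¹) / 4 with hK
  set ρ : ℝ := 2 ^ (s - 1) with hρ
  have hρ1 : ρ < 1 := Real.rpow_lt_one_of_one_lt_of_neg one_lt_two (by linarith)
  have hρ0 : 0 < ρ := by positivity
  have hK0 : 0 ≤ K := by
    have : (1 : ℝ) < 2 ^ (1 - s) := Real.one_lt_rpow one_lt_two (by linarith)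
    have : 0 < (2 : ℝ) ^ (1 - s) - 1 := by linarith
    positivity
  -- `ρ` is the coefficient of the absorbed term
  refine ⟨(ENNReal.ofReal (1 - ρ))⁻¹ * (ENNReal.ofReal K * C), ?_, fun v hv hfin => ?_⟩
  · have : (ENNReal.ofReal (1 - ρ)) ≠ 0 := by simpa using hρ1
    finiteness
  set X := ∫⁻ h, kern (n + 2 * s) h * ∫⁻ x, ENNReal.ofReal (‖v (x + h) - v x‖ ^ 2) with hX
  have hIm : Measurable fun h => ∫⁻ x, ENNReal.ofReal (‖v (x + h) - v x‖ ^ 2) :=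
    Measurable.lintegral_prod_right'
      (f := fun p : Eu n × Eu n => ENNReal.ofReal (‖v (p.2 + p.1) - v p.2‖ ^ 2)) (by fun_prop)
  have hsecm : Measurable fun h => ∫⁻ x, ENNReal.ofReal
      (‖v (x + h + h) - v (x + h) - (v (x + h) - v x)‖ ^ 2) :=
    Measurable.lintegral_prod_right'
      (f := fun p : Eu n × Eu n => ENNReal.ofReal
        (‖v (p.2 + p.1 + p.1) - v (p.2 + p.1) - (v (p.2 + p.1) - v p.2)‖ ^ 2)) (by fun_prop)
  set T : Eu n →L[ℝ] Eu n := (2 : ℝ) • ContinuousLinearMap.id ℝ (Eu n) with hT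
  have hTm := T.continuous.measurable
  have hTinj : Function.Injective T := fun a b h =>
    smul_right_injective _ (two_ne_zero (α := ℝ)) h
  have hT2 : ‖T‖ ≤ 2 := by
    rw [hT, norm_smul, Real.norm_two]
    linarith [ContinuousLinearMap.norm_id_le (𝕜 := ℝ) (E := Eu n)]
  have hdet : LinearMap.det (T : Eu n →ₗ[ℝ] Eu n) = 2 ^ n := by
    have : (T : Eu n →ₗ[ℝ] Eu n) = (2 : ℝ) • LinearMap.id := rfl
    rw [this, LinearMap.det_smul]
    simp
  have hdil : ∫⁻ h, kern (n + 2 * s) h * ∫⁻ x, ENNReal.ofReal (‖v (x + T h) - v x‖ ^ 2) ≤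
      ENNReal.ofReal (2 ^ (2 * s)) * X := by
    refine (lintegral_kern_comp_le ht T hTinj hIm).trans ?_
    rw [hdet, ← ENNReal.ofReal_mul (by positivity)]
    gcongr
    rw [abs_of_nonneg (by positivity)]
    calc ‖T‖ ^ ((n : ℝ) + 2 * s) * ((2 : ℝ) ^ n)⁻¹
        ≤ 2 ^ ((n : ℝ) + 2 * s) * ((2 : ℝ) ^ n)⁻¹ := by gcongr
      _ = 2 ^ (2 * s) := by
        rw [Real.rpow_add two_pos, Real.rpow_natCast]
        field_simp
  have hmain : X ≤ ENNReal.ofReal ρ * X +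
      ENNReal.ofReal K * (C * ∫⁻ h, kern (n + 2 * s + 2) h * strain v h) := by
    calc X ≤ ∫⁻ h, (ENNReal.ofReal (2 ^ (1 - s) / 4) *
            (kern (n + 2 * s) h * ∫⁻ x, ENNReal.ofReal (‖v (x + T h) - v x‖ ^ 2)) +
          ENNReal.ofReal K * (kern (n + 2 * s) h * ∫⁻ x, ENNReal.ofReal
            (‖v (x + h + h) - v (x + h) - (v (x + h) - v x)‖ ^ 2))) := by
          refine lintegral_mono fun h => ?_
          rw [mul_left_comm, mul_left_comm (ENNReal.ofReal K), ← mul_add]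
          gcongr
          rw [← lintegral_const_mul _ (by fun_prop), ← lintegral_const_mul _ (by fun_prop),
            ← lintegral_add_right _ (by fun_prop)]
          refine lintegral_mono fun x => ?_
          rw [← ENNReal.ofReal_mul (by positivity), ← ENNReal.ofReal_mul hK0,
            ← ENNReal.ofReal_add (by positivity) (by positivity)]
          apply ENNReal.ofReal_le_ofReal
          apply norm_sq_le_of_eq_half_sub hs1
          have hTh : x + T h = x + h + h := by
            rw [hT, _root_.smul_apply, ContinuousLinearMap.id_apply, two_smul]
            abel
          rw [hTh]
          module
      _ = ENNReal.ofReal (2 ^ (1 - s) / 4) *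
            (∫⁻ h, kern (n + 2 * s) h * ∫⁻ x, ENNReal.ofReal (‖v (x + T h) - v x‖ ^ 2)) +
          ENNReal.ofReal K * (∫⁻ h, kern (n + 2 * s) h * ∫⁻ x, ENNReal.ofReal
            (‖v (x + h + h) - v (x + h) - (v (x + h) - v x)‖ ^ 2)) := by
          have hIT : Measurable fun h => ∫⁻ x, ENNReal.ofReal (‖v (x + T h) - v x‖ ^ 2) :=
            hIm.comp hTm
          rw [lintegral_add_right _ (by fun_prop), lintegral_const_mul _ (by fun_prop),
            lintegral_const_mul _ (by fun_prop)]
      _ ≤ ENNReal.ofReal (2 ^ (1 - s) / 4) * (ENNReal.ofReal (2 ^ (2 * s)) * X) +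
          ENNReal.ofReal K * (C * ∫⁻ h, kern (n + 2 * s + 2) h * strain v h) := by
          gcongr
          exact hCv v hv
      _ = _ := by
          rw [← mul_assoc, ← ENNReal.ofReal_mul (by positivity)]
          congr 3
          have h4 : (4 : ℝ) = 2 ^ (2 : ℝ) := by norm_num
          rw [h4, ← Real.rpow_sub two_pos, ← Real.rpow_add two_pos]
          congr 1
          ring
  have hsplit : ENNReal.ofReal ρ * X + ENNReal.ofReal (1 - ρ) * X = X := by
    rw [← add_mul, ← ENNReal.ofReal_add hρ0.le (by linarith)]
    simp
  -- absorption needs the seminorm to be finite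
  have hfinal : ENNReal.ofReal (1 - ρ) * X ≤
      ENNReal.ofReal K * (C * ∫⁻ h, kern (n + 2 * s + 2) h * strain v h) := by
    refine (ENNReal.add_le_add_iff_left (a := ENNReal.ofReal ρ * X) (by finiteness)).1 ?_
    rwa [hsplit]
  rw [mul_assoc, mul_assoc, ← ENNReal.mul_le_iff_le_inv (by simpa using hρ1) (by simp)]
  exact hfinal

/-! ### Difference quotients: Korn and Poincaré inequalities -/

/-- The longitudinal difference quotient
`|x - y| ^ (-n/2 - s) (v(y) - v(x)) · (y - x) / |y - x|`, which is `0` on the diagonal. -/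
noncomputable def longQuot (s : ℝ) (v : Eu n → Eu n) (p : Eu n × Eu n) : ℝ :=
  ⟪diffQuot s v p, ‖p.2 - p.1‖⁻¹ • (p.2 - p.1)⟫

theorem measurable_diffQuot (s : ℝ) {v : Eu n → Eu n} (hv : Measurable v) :
    Measurable (diffQuot s v) := by
  unfold diffQuot
  fun_prop

theorem measurable_longQuot (s : ℝ) {v : Eu n → Eu n} (hv : Measurable v) :
    Measurable (longQuot s v) := by
  have := measurable_diffQuot s hv
  unfold longQuot
  fun_prop

theorem norm_inv_norm_smul_le_one (w : Eu n) : ‖‖w‖⁻¹ • w‖ ≤ 1 := by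
  rw [norm_smul, norm_inv, norm_norm]
  exact inv_mul_le_one

theorem abs_longQuot_le (s : ℝ) (v : Eu n → Eu n) (p : Eu n × Eu n) :
    |longQuot s v p| ≤ ‖diffQuot s v p‖ :=
  (abs_real_inner_le_norm _ _).trans
    (mul_le_of_le_one_right (norm_nonneg _) (norm_inv_norm_smul_le_one _))

theorem longQuot_sq_le (s : ℝ) (v : Eu n → Eu n) (p : Eu n × Eu n) :
    longQuot s v p ^ 2 ≤ ‖diffQuot s v p‖ ^ 2 := by
  rw [← sq_abs]
  exact pow_le_pow_left₀ (abs_nonneg _) (abs_longQuot_le s v p) 2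

theorem inv_rpow_half_sq (t : ℝ) (h : Eu n) :
    ((‖h‖ ^ (t / 2))⁻¹) ^ 2 = ‖h‖ ^ (-t) := by
  rw [← Real.rpow_neg (norm_nonneg _), ← Real.rpow_natCast, ← Real.rpow_mul (norm_nonneg _)]
  congr 1
  push_cast
  ring

theorem ofReal_norm_sq_diffQuot (s : ℝ) (v : Eu n → Eu n) (x y : Eu n) :
    ENNReal.ofReal (‖diffQuot s v (x, y)‖ ^ 2) =
      kern (n + 2 * s) (y - x) * ENNReal.ofReal (‖v y - v x‖ ^ 2) := by
  have h := inv_rpow_half_sq (n + 2 * s) (y - x)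
  have e : ((n : ℝ) + 2 * s) / 2 = n / 2 + s := by ring
  rw [e] at h
  rw [diffQuot, norm_smul, mul_pow, norm_inv, Real.norm_of_nonneg (by positivity),
    norm_sub_rev x y, h, kern, ENNReal.ofReal_mul (by positivity)]

theorem ofReal_sq_longQuot {s : ℝ} (hs : 0 < s) (v : Eu n → Eu n) (x y : Eu n) :
    ENNReal.ofReal (longQuot s v (x, y) ^ 2) =
      kern (n + 2 * s + 2) (y - x) * ENNReal.ofReal (⟪v y - v x, y - x⟫ ^ 2) := by
  have h := inv_rpow_half_sq (n + 2 * s) (y - x)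
  have e : ((n : ℝ) + 2 * s) / 2 = n / 2 + s := by ring
  rw [e] at h
  rw [longQuot, diffQuot, real_inner_smul_left, real_inner_smul_right, mul_pow, mul_pow,
    norm_sub_rev x y, h, kern, ← ENNReal.ofReal_mul (by positivity), ← mul_assoc]
  congr 2
  rcases eq_or_ne (y - x) 0 with hw | hw
  · rw [hw, norm_zero, Real.zero_rpow (by have := n.cast_nonneg (α := ℝ); linarith),
      Real.zero_rpow (by have := n.cast_nonneg (α := ℝ); linarith), zero_mul]
  · have hpos : 0 < ‖y - x‖ := norm_pos_iff.2 hw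
    rw [neg_add (_ + _) (2 : ℝ), Real.rpow_add hpos, inv_pow, Real.rpow_neg hpos.le 2,
      Real.rpow_two]

theorem lintegral_mul_diffQuot_sq (s : ℝ) {v : Eu n → Eu n} (hv : Measurable v)
    {g : Eu n → ℝ≥0∞} (hg : Measurable g) :
    ∫⁻ p : Eu n × Eu n, g (p.2 - p.1) * ENNReal.ofReal (‖diffQuot s v p‖ ^ 2) =
      ∫⁻ h, g h * kern (n + 2 * s) h * ∫⁻ x, ENNReal.ofReal (‖v (x + h) - v x‖ ^ 2) := by
  have := measurable_diffQuot s hv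
  rw [lintegral_prod_eq_shift (by fun_prop)]
  refine lintegral_congr fun h => ?_
  rw [← lintegral_const_mul _ (by fun_prop)]
  refine lintegral_congr fun x => ?_
  rw [ofReal_norm_sq_diffQuot, add_sub_cancel_left, mul_assoc]

theorem lintegral_longQuot_sq {s : ℝ} (hs : 0 < s) {v : Eu n → Eu n} (hv : Measurable v) :
    ∫⁻ p, ENNReal.ofReal (longQuot s v p ^ 2) = ∫⁻ h, kern (n + 2 * s + 2) h * strain v h := by
  have := measurable_longQuot s hv
  rw [lintegral_prod_eq_shift (by fun_prop)]
  refine lintegral_congr fun h => ?_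
  rw [strain, ← lintegral_const_mul _ (by fun_prop)]
  refine lintegral_congr fun x => ?_
  rw [ofReal_sq_longQuot hs, add_sub_cancel_left]

/-- The fractional Korn inequality in terms of difference quotients. -/
theorem exists_korn_quot (n : ℕ) {s : ℝ} (hs : s ∈ Ioo (0 : ℝ) 1) :
    ∃ C : ℝ≥0∞, C ≠ ⊤ ∧ ∀ v : Eu n → Eu n, Measurable v →
      ∫⁻ p, ENNReal.ofReal (‖diffQuot s v p‖ ^ 2) ≠ ⊤ →
      ∫⁻ p, ENNReal.ofReal (‖diffQuot s v p‖ ^ 2) ≤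
        C * ∫⁻ p, ENNReal.ofReal (longQuot s v p ^ 2) := by
  obtain ⟨C, hC, hCv⟩ := exists_korn n hs
  refine ⟨C, hC, fun v hv => ?_⟩
  have h1 := lintegral_mul_diffQuot_sq s hv (g := fun _ => 1) measurable_const
  simp only [one_mul] at h1
  rw [h1, lintegral_longQuot_sq hs.1 hv]
  exact hCv v hv

/-- Fractional Poincaré inequality: a ball outside `Ω` sees every point of `Ω` from a bounded
distance. -/
theorem exists_poincare (hn : 1 ≤ n) {s : ℝ} (hs : 0 < s) {Ω : Set (Eu n)}
    (hΩ : Bornology.IsBounded Ω) :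
    ∃ C : ℝ≥0∞, C ≠ ⊤ ∧ ∀ v : Eu n → Eu n, Measurable v → (∀ᵐ x, x ∉ Ω → v x = 0) →
      ∫⁻ x, ENNReal.ofReal (‖v x‖ ^ 2) ≤
        C * ∫⁻ p, ENNReal.ofReal (‖diffQuot s v p‖ ^ 2) := by
  have : Nonempty (Fin n) := ⟨⟨0, hn⟩⟩
  obtain ⟨R, hR0, hR⟩ := hΩ.exists_pos_norm_le
  obtain ⟨y₀, hy₀⟩ := NormedSpace.exists_lt_norm ℝ (Eu n) (R + 1)
  set M : ℝ := R + (‖y₀‖ + 1) with hM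
  set B := Metric.ball y₀ 1 with hB
  have hM0 : 0 < M := by positivity
  have hBΩ : ∀ y ∈ B, y ∉ Ω := by
    intro y hy hyΩ
    have h1 := hR y hyΩ
    have h2 : ‖y - y₀‖ < 1 := by simpa [hB, dist_eq_norm] using hy
    have h3 := norm_sub_norm_le y₀ y
    rw [norm_sub_rev] at h3
    linarith
  -- `M` bounds `|x - y|` for `x ∈ Ω` and `y ∈ B`
  set c : ℝ≥0∞ := ENNReal.ofReal (M ^ (-((n : ℝ) + 2 * s))) * volume B with hc
  have hc0 : c ≠ 0 := by
    refine mul_ne_zero ?_ (Metric.measure_ball_pos _ _ one_pos).ne'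
    simp only [ne_eq, ENNReal.ofReal_eq_zero, not_le]
    positivity
  have hct : c ≠ ⊤ := ENNReal.mul_ne_top ENNReal.ofReal_ne_top measure_ball_lt_top.ne
  refine ⟨c⁻¹, ENNReal.inv_ne_top.2 hc0, fun v hv hvΩ => ?_⟩
  rw [← ENNReal.mul_le_iff_le_inv hc0 hct, ← lintegral_const_mul _ (by fun_prop)]
  have := measurable_diffQuot s hv
  rw [Measure.volume_eq_prod, lintegral_prod _ (by fun_prop)]
  refine lintegral_mono_ae ?_
  filter_upwards [hvΩ] with x hx
  by_cases hxΩ : x ∈ Ω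
  swap
  · simp [hx hxΩ]
  calc c * ENNReal.ofReal (‖v x‖ ^ 2)
      = ∫⁻ _y in B, ENNReal.ofReal (M ^ (-((n : ℝ) + 2 * s))) * ENNReal.ofReal (‖v x‖ ^ 2) := by
        rw [setLIntegral_const, hc]
        ring
    _ ≤ ∫⁻ y in B, ENNReal.ofReal (‖diffQuot s v (x, y)‖ ^ 2) := by
        refine setLIntegral_mono_ae (by fun_prop) ?_
        filter_upwards [hvΩ] with y hy hyB
        rw [ofReal_norm_sq_diffQuot, hy (hBΩ y hyB), zero_sub, norm_neg]
        gcongr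
        unfold kern
        apply ENNReal.ofReal_le_ofReal
        have hxy : 0 < ‖y - x‖ := by
          rw [norm_pos_iff, sub_ne_zero]
          rintro rfl
          exact hBΩ y hyB hxΩ
        refine Real.rpow_le_rpow_of_nonpos hxy ?_
          (by have := n.cast_nonneg (α := ℝ); linarith)
        have h2 : ‖y - y₀‖ < 1 := by simpa [hB, dist_eq_norm] using hyB
        have h3 := norm_sub_norm_le y y₀
        have h4 := norm_sub_le y x
        have h5 := hR x hxΩ
        linarith
    _ ≤ _ := setLIntegral_le_lintegral _ _

/-- Differences of `v` weighted by an integrable kernel are controlled by the `L²` norm of `v`. -/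
theorem lintegral_mul_diffQuot_sq_le (s : ℝ) {v : Eu n → Eu n} (hv : Measurable v)
    {g : Eu n → ℝ≥0∞} (hg : Measurable g) :
    ∫⁻ p : Eu n × Eu n, g (p.2 - p.1) * ENNReal.ofReal (‖diffQuot s v p‖ ^ 2) ≤
      (∫⁻ h, g h * kern (n + 2 * s) h) * (4 * ∫⁻ x, ENNReal.ofReal (‖v x‖ ^ 2)) := by
  rw [lintegral_mul_diffQuot_sq s hv hg, ← lintegral_mul_const _ (by fun_prop)]
  refine lintegral_mono fun h => ?_
  gcongr
  calc ∫⁻ x, ENNReal.ofReal (‖v (x + h) - v x‖ ^ 2)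
      ≤ ∫⁻ x, 2 * (ENNReal.ofReal (‖v (x + h)‖ ^ 2) + ENNReal.ofReal (‖v x‖ ^ 2)) := by
        refine lintegral_mono fun x => ?_
        have h2 : ∀ a : ℝ, 2 * ENNReal.ofReal a = ENNReal.ofReal (2 * a) := fun a => by
          rw [ENNReal.ofReal_mul zero_le_two, ENNReal.ofReal_ofNat]
        rw [← ENNReal.ofReal_add (by positivity) (by positivity), h2]
        apply ENNReal.ofReal_le_ofReal
        have := pow_le_pow_left₀ (norm_nonneg _) (norm_sub_le (v (x + h)) (v x)) 2
        nlinarith [sq_nonneg (‖v (x + h)‖ - ‖v x‖)]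
    _ = 4 * ∫⁻ x, ENNReal.ofReal (‖v x‖ ^ 2) := by
        rw [lintegral_const_mul _ (by fun_prop), lintegral_add_right _ (by fun_prop),
          lintegral_add_right_eq_self (fun x => ENNReal.ofReal (‖v x‖ ^ 2))]
        ring

/-- Above the exponent `n` the kernel is integrable at infinity. -/
theorem lintegral_kern_compl_ball_ne_top (hn : 1 ≤ n) {t : ℝ} (ht : (n : ℝ) < t)
    (ht2 : t < n + 2) :
    ∫⁻ h : Eu n, {h | 1 < ‖h‖}.indicator (kern t) h ≠ ⊤ := by
  have hi := integrable_kernel (n := n) (by lia) (s := (t - n) / 2)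
    ⟨by linarith, by linarith⟩ 0 1
  convert hi.lintegral_lt_top.ne using 1
  refine lintegral_congr fun h => ?_
  by_cases hh : ‖h‖ ≤ 1
  · rw [indicator_of_notMem (by simpa using hh)]
    simp [hh]
  · rw [indicator_of_mem (by simpa using hh), kern]
    simp only [hh, if_false]
    congr 1
    rw [one_mul]
    congr 1
    ring

/-! ### Coercivity -/

variable {s : ℝ}

theorem measurable_field (v : Sobolev n s) : Measurable (field v) :=
  (Lp.stronglyMeasurable (v : Lp (Eu n) 2 (volume : Measure (Eu n)))).measurable

theorem integrable_norm_sq_field (v : Sobolev n s) : Integrable fun x => ‖field v x‖ ^ 2 :=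
  (memLp_two_iff_integrable_sq_norm (measurable_field v).aestronglyMeasurable).1
    (Lp.memLp (v : Lp (Eu n) 2 (volume : Measure (Eu n))))

theorem memLp_diffQuot_field (v : Sobolev n s) : MemLp (diffQuot s (field v)) 2 volume := v.2

theorem integrable_norm_sq_diffQuot (v : Sobolev n s) :
    Integrable fun p => ‖diffQuot s (field v) p‖ ^ 2 :=
  (memLp_two_iff_integrable_sq_norm
    (measurable_diffQuot s (measurable_field v)).aestronglyMeasurable).1 (memLp_diffQuot_field v)

theorem memLp_longQuot_field (v : Sobolev n s) : MemLp (longQuot s (field v)) 2 volume :=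
  (memLp_diffQuot_field v).mono (measurable_longQuot s (measurable_field v)).aestronglyMeasurable
    (.of_forall fun p => abs_longQuot_le s _ p)

theorem integrable_longQuot_sq (v : Sobolev n s) :
    Integrable fun p => longQuot s (field v) p ^ 2 :=
  (memLp_longQuot_field v).integrable_sq

/-- On fields vanishing outside a bounded set, the full `Hˢ` norm is controlled by the longitudinal
difference quotients. -/
theorem exists_korn_poincare (hn : 1 ≤ n) (hs : s ∈ Ioo (0 : ℝ) 1) {Ω : Set (Eu n)}
    (hΩ : Bornology.IsBounded Ω) :
    ∃ K : ℝ, 0 < K ∧ ∀ v ∈ vanishingOutside s Ω,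
      ∫ x, ‖field v x‖ ^ 2 ≤ K * ∫ p, longQuot s (field v) p ^ 2 ∧
      ∫ p, ‖diffQuot s (field v) p‖ ^ 2 ≤ K * ∫ p, longQuot s (field v) p ^ 2 := by
  obtain ⟨C, hC, hCv⟩ := exists_korn_quot n hs
  obtain ⟨D, hD, hDv⟩ := exists_poincare hn hs.1 hΩ
  refine ⟨(C + D * C).toReal + 1, by positivity, fun v hv => ?_⟩
  have hm := measurable_field v
  have key : ∀ K' : ℝ≥0∞, ∀ I : ℝ, K' ≤ C + D * C →
      ENNReal.ofReal I ≤ K' * ENNReal.ofReal (∫ p, longQuot s (field v) p ^ 2) →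
      I ≤ ((C + D * C).toReal + 1) * ∫ p, longQuot s (field v) p ^ 2 := by
    intro K' I hK hI
    have h0 : 0 ≤ ∫ p, longQuot s (field v) p ^ 2 := integral_nonneg fun p => sq_nonneg _
    have hfin : C + D * C ≠ ⊤ := by finiteness
    have h1 : ENNReal.ofReal I ≤
        (C + D * C) * ENNReal.ofReal (∫ p, longQuot s (field v) p ^ 2) := hI.trans (by gcongr)
    rw [← ENNReal.ofReal_toReal hfin, ← ENNReal.ofReal_mul ENNReal.toReal_nonneg] at h1
    have h2 := (ENNReal.ofReal_le_ofReal_iff (mul_nonneg ENNReal.toReal_nonneg h0)).1 h1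
    linarith
  have hE := ofReal_integral_eq_lintegral_ofReal (integrable_longQuot_sq v)
    (.of_forall fun p => sq_nonneg _)
  have hG := ofReal_integral_eq_lintegral_ofReal (integrable_norm_sq_diffQuot v)
    (.of_forall fun p => sq_nonneg _)
  have hN := ofReal_integral_eq_lintegral_ofReal (integrable_norm_sq_field v)
    (.of_forall fun p => sq_nonneg _)
  have h1 := hCv _ hm (by rw [← hG]; exact ENNReal.ofReal_ne_top)
  rw [← hE, ← hG] at h1
  have h2 := hDv _ hm hv
  rw [← hN, ← hG] at h2
  refine ⟨key (D * C) _ le_add_self ?_, key C _ le_self_add h1⟩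
  rw [mul_assoc]
  exact h2.trans (by gcongr)

/-- Longitudinal differences weighted by `g (y - x)`, where `g` times the kernel is integrable. -/
theorem integral_mul_longQuot_sq_le (v : Sobolev n s) {g : Eu n → ℝ} (hg : Measurable g)
    (hg0 : ∀ h, 0 ≤ g h) {κ : ℝ} (hκ0 : 0 ≤ κ)
    (hκ : ∫⁻ h, ENNReal.ofReal (g h) * kern (n + 2 * s) h ≤ ENNReal.ofReal κ) :
    Integrable (fun p : Eu n × Eu n => g (p.2 - p.1) * longQuot s (field v) p ^ 2) ∧
      ∫ p : Eu n × Eu n, g (p.2 - p.1) * longQuot s (field v) p ^ 2 ≤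
        4 * κ * ∫ x, ‖field v x‖ ^ 2 := by
  have hm := measurable_field v
  have hmq := measurable_longQuot s hm
  have h0 : ∀ p : Eu n × Eu n, 0 ≤ g (p.2 - p.1) * longQuot s (field v) p ^ 2 := fun p =>
    mul_nonneg (hg0 _) (sq_nonneg _)
  have hN := ofReal_integral_eq_lintegral_ofReal (integrable_norm_sq_field v)
    (.of_forall fun p => sq_nonneg _)
  have hN0 : 0 ≤ ∫ x, ‖field v x‖ ^ 2 := integral_nonneg fun p => sq_nonneg _
  have hle : ∫⁻ p : Eu n × Eu n, ENNReal.ofReal (g (p.2 - p.1) * longQuot s (field v) p ^ 2) ≤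
      ENNReal.ofReal (4 * κ * ∫ x, ‖field v x‖ ^ 2) := by
    calc _ ≤ ∫⁻ p : Eu n × Eu n, ENNReal.ofReal (g (p.2 - p.1)) *
            ENNReal.ofReal (‖diffQuot s (field v) p‖ ^ 2) := by
          refine lintegral_mono fun p => ?_
          rw [ENNReal.ofReal_mul (hg0 _)]
          exact mul_le_mul' le_rfl (ENNReal.ofReal_le_ofReal (longQuot_sq_le s _ p))
      _ ≤ (∫⁻ h, ENNReal.ofReal (g h) * kern (n + 2 * s) h) *
            (4 * ∫⁻ x, ENNReal.ofReal (‖field v x‖ ^ 2)) :=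
          lintegral_mul_diffQuot_sq_le s hm (g := fun h => ENNReal.ofReal (g h)) (by fun_prop)
      _ ≤ ENNReal.ofReal κ * (4 * ∫⁻ x, ENNReal.ofReal (‖field v x‖ ^ 2)) := by gcongr
      _ = _ := by
          rw [← hN, mul_comm 4 κ, mul_assoc, ENNReal.ofReal_mul hκ0,
            ENNReal.ofReal_mul (by norm_num : (0 : ℝ) ≤ 4)]
          simp
  have hint : Integrable (fun p : Eu n × Eu n => g (p.2 - p.1) * longQuot s (field v) p ^ 2) := by
    refine ⟨by fun_prop, ?_⟩
    rw [hasFiniteIntegral_iff_ofReal (.of_forall h0)]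
    exact hle.trans_lt ENNReal.ofReal_lt_top
  refine ⟨hint, ?_⟩
  rw [← ofReal_integral_eq_lintegral_ofReal hint (.of_forall h0)] at hle
  exact (ENNReal.ofReal_le_ofReal_iff (by positivity)).1 hle

namespace CoeffClass

variable {α lam Lam : ℝ} {A : Eu n → Eu n → ℝ}

/-- An infimum of an unbounded family is `0` in `ℝ`, so `0 < λ < inf A(x, x)` forces boundedness. -/
theorem lt_diag (hA : CoeffClass α lam Lam A) (hlam : 0 < lam) (x : Eu n) : lam < A x x := by
  have hb : BddBelow (range fun x => A x x) := by
    by_contra hb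
    have := hA.lt_iInf_diag
    rw [Real.iInf_of_not_bddBelow hb] at this
    linarith
  exact hA.lt_iInf_diag.trans_le (ciInf_le hb x)

theorem sub_le (hA : CoeffClass α lam Lam A) (hlam : 0 < lam) (x y : Eu n) :
    lam - Lam * ‖y - x‖ ^ α ≤ A x y := by
  have h1 := hA.lt_diag hlam x
  have h2 := hA.holder x y x
  have h3 := neg_abs_le (A x y - A x x)
  linarith

/-- The coefficient is Hölder in each variable uniformly in the other one, hence continuous. -/
theorem continuous (hA : CoeffClass α lam Lam A) (hα : 0 < α) :
    Continuous fun p : Eu n × Eu n => A p.1 p.2 := by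
  rw [continuous_iff_continuousAt]
  intro p₀
  rw [ContinuousAt, tendsto_iff_norm_sub_tendsto_zero]
  have hc : Continuous fun p : Eu n × Eu n =>
      Lam * ‖p.2 - p₀.2‖ ^ α + Lam * ‖p.1 - p₀.1‖ ^ α := by
    have h1 : Continuous fun p : Eu n × Eu n => ‖p.2 - p₀.2‖ ^ α :=
      (by fun_prop : Continuous fun p : Eu n × Eu n => ‖p.2 - p₀.2‖).rpow_const
        fun _ => Or.inr hα.le
    have h2 : Continuous fun p : Eu n × Eu n => ‖p.1 - p₀.1‖ ^ α :=
      (by fun_prop : Continuous fun p : Eu n × Eu n => ‖p.1 - p₀.1‖).rpow_const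
        fun _ => Or.inr hα.le
    fun_prop
  refine squeeze_zero (fun _ => norm_nonneg _) (fun p => ?_)
    (by simpa [Real.zero_rpow hα.ne'] using hc.tendsto p₀)
  have h1 := hA.holder p.1 p.2 p₀.2
  have h2 := hA.holder p₀.2 p.1 p₀.1
  rw [hA.symm p₀.2 p.1, hA.symm p₀.2 p₀.1] at h2
  exact (abs_sub_le _ (A p.1 p₀.2) _).trans (add_le_add h1 h2)

theorem ae_abs_le (hA : CoeffClass α lam Lam A) (hlam : 0 < lam) :
    ∀ᵐ p : Eu n × Eu n, |A p.1 p.2| ≤ 1 / lam := by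
  have h := hA.bound
  rw [eLpNorm_exponent_top] at h
  filter_upwards [enorm_ae_le_eLpNormEssSup (fun p : Eu n × Eu n => A p.1 p.2) volume] with p hp
  have h1 := hp.trans h
  rw [← ofReal_norm] at h1
  exact (ENNReal.ofReal_le_ofReal_iff (by positivity)).1 h1

theorem integrable_form (hA : CoeffClass α lam Lam A) (hα : 0 < α) (hlam : 0 < lam)
    (u v : Sobolev n s) :
    Integrable fun p : Eu n × Eu n =>
      A p.1 p.2 * (longQuot s (field u) p * longQuot s (field v) p) :=
  ((memLp_longQuot_field u).integrable_mul (memLp_longQuot_field v)).bdd_mul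
    (hA.continuous hα).aestronglyMeasurable (hA.ae_abs_le hlam)

/-- The pairing as an integral over `ℝⁿ × ℝⁿ` of difference quotients. -/
theorem pairing_eq (hA : CoeffClass α lam Lam A) (hα : 0 < α) (hlam : 0 < lam)
    (u v : Sobolev n s) :
    pairing s A (field u) (field v) = ∫ p : Eu n × Eu n,
      A p.1 p.2 * (longQuot s (field u) p * longQuot s (field v) p) := by
  rw [Measure.volume_eq_prod, integral_prod _ (hA.integrable_form hα hlam u v), pairing]
  refine integral_congr_ae (.of_forall fun x => integral_congr_ae (.of_forall fun y => ?_))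
  have h := inv_rpow_half_sq (n + 2 * s) (x - y)
  have e : ((n : ℝ) + 2 * s) / 2 = n / 2 + s := by ring
  rw [e, Real.rpow_neg (norm_nonneg _)] at h
  simp only [longQuot, diffQuot, real_inner_smul_left, div_eq_mul_inv, ← h]
  ring

/-- Lower bound for the energy when `α < 2 s`, by `A(x, y) ≥ λ - Λ |x - y| ^ α`; the weight
`|x - y| ^ α` is at most `1` near the diagonal and leaves the kernel integrable at infinity. -/
theorem le_integral_of_lt_two_mul (hA : CoeffClass α lam Lam A) (hα : 0 < α) (hlam : 0 < lam)
    (hLam : 0 < Lam) {K κ : ℝ} (hκ0 : 0 ≤ κ)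
    (hκ : ∫⁻ h : Eu n, {h | 1 < ‖h‖}.indicator (kern (n + 2 * s - α)) h ≤ ENNReal.ofReal κ)
    (hC : 2 * (1 + 4 * κ * K) < lam / Lam) {v : Sobolev n s}
    (hv : ∫ x, ‖field v x‖ ^ 2 ≤ K * ∫ p, longQuot s (field v) p ^ 2) :
    lam / 2 * ∫ p, longQuot s (field v) p ^ 2 ≤ ∫ p : Eu n × Eu n,
      A p.1 p.2 * (longQuot s (field v) p * longQuot s (field v) p) := by
  set g : Eu n → ℝ := {h | 1 < ‖h‖}.indicator fun h => ‖h‖ ^ α with hg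
  have hgm : Measurable g := Measurable.indicator (by fun_prop)
    (measurableSet_lt measurable_const measurable_norm)
  have hg0 : ∀ h, 0 ≤ g h := fun h => indicator_nonneg (fun _ _ => by positivity) h
  have hgκ : ∫⁻ h, ENNReal.ofReal (g h) * kern (n + 2 * s) h ≤ ENNReal.ofReal κ := by
    refine le_trans (le_of_eq (lintegral_congr fun h => ?_)) hκ
    by_cases hh : 1 < ‖h‖
    · rw [hg, indicator_of_mem (by exact hh), indicator_of_mem (by exact hh), kern, kern,
        ← ENNReal.ofReal_mul (by positivity), ← Real.rpow_add (by linarith)]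
      congr 2
      ring
    · rw [hg, indicator_of_notMem (by exact hh), indicator_of_notMem (by exact hh)]
      simp
  obtain ⟨hi, hle⟩ := integral_mul_longQuot_sq_le v hgm hg0 hκ0 hgκ
  have hE := integrable_longQuot_sq v
  have hE0 : 0 ≤ ∫ p, longQuot s (field v) p ^ 2 := integral_nonneg fun p => sq_nonneg _
  have hmono : ∫ p : Eu n × Eu n, ((lam - Lam) * longQuot s (field v) p ^ 2 -
      Lam * (g (p.2 - p.1) * longQuot s (field v) p ^ 2)) ≤ ∫ p : Eu n × Eu n,
      A p.1 p.2 * (longQuot s (field v) p * longQuot s (field v) p) := by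
    refine integral_mono ((hE.const_mul _).sub (hi.const_mul _))
      (hA.integrable_form hα hlam v v) fun p => ?_
    have h1 := hA.sub_le hlam p.1 p.2
    have h2 : ‖p.2 - p.1‖ ^ α ≤ 1 + g (p.2 - p.1) := by
      by_cases hh : 1 < ‖p.2 - p.1‖
      · rw [hg, indicator_of_mem (by exact hh)]
        linarith
      · have := Real.rpow_le_one (norm_nonneg _) (not_lt.1 hh) hα.le
        linarith [hg0 (p.2 - p.1)]
    have h3 : lam - Lam - Lam * g (p.2 - p.1) ≤ A p.1 p.2 := by nlinarith
    have h4 := mul_le_mul_of_nonneg_right h3 (sq_nonneg (longQuot s (field v) p))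
    dsimp only
    nlinarith
  rw [integral_sub (hE.const_mul _) (hi.const_mul _), integral_const_mul,
    integral_const_mul] at hmono
  refine le_trans ?_ hmono
  rw [lt_div_iff₀ hLam] at hC
  have h5 : ∫ p : Eu n × Eu n, g (p.2 - p.1) * longQuot s (field v) p ^ 2 ≤
      4 * κ * K * ∫ p, longQuot s (field v) p ^ 2 := by
    rw [mul_assoc (4 * κ)]
    exact hle.trans (by gcongr)
  have h6 := mul_le_mul_of_nonneg_left h5 hLam.le
  have h7 := mul_le_mul_of_nonneg_right hC.le hE0
  nlinarith

/-- Lower bound for the energy with a cut at distance `r`: within it `A ≥ λ - Λ r ^ α`, beyond it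
`A ≥ -1/λ` and the kernel is small in `L¹`. -/
theorem le_integral_of_cut (hA : CoeffClass α lam Lam A) (hα : 0 < α) (hs : 0 < s) (hlam : 0 < lam)
    (hLam : 0 < Lam) {K κ r : ℝ} (hκ0 : 0 ≤ κ) (hr : 1 ≤ r)
    (hκ : ∫⁻ h : Eu n, {h | 1 < ‖h‖}.indicator (kern (n + s)) h ≤ ENNReal.ofReal κ)
    (hrκ : (lam + 1 / lam) * (4 * κ * K) ≤ lam / 4 * r ^ s)
    (hC : 4 * r ^ α < lam / Lam) {v : Sobolev n s}
    (hv : ∫ x, ‖field v x‖ ^ 2 ≤ K * ∫ p, longQuot s (field v) p ^ 2) :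
    lam / 2 * ∫ p, longQuot s (field v) p ^ 2 ≤ ∫ p : Eu n × Eu n,
      A p.1 p.2 * (longQuot s (field v) p * longQuot s (field v) p) := by
  -- beyond `r` the factor `r ^ s ≤ ‖h‖ ^ s` still leaves the integrable kernel `‖h‖ ^ (-n - s)`
  set g : Eu n → ℝ := {h | r < ‖h‖}.indicator fun _ => r ^ s with hg
  have hr0 : 0 < r := by linarith
  have hgm : Measurable g := Measurable.indicator (by fun_prop)
    (measurableSet_lt measurable_const measurable_norm)
  have hg0 : ∀ h, 0 ≤ g h := fun h => indicator_nonneg (fun _ _ => by positivity) h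
  have hgκ : ∫⁻ h, ENNReal.ofReal (g h) * kern (n + 2 * s) h ≤ ENNReal.ofReal κ := by
    refine le_trans (lintegral_mono fun h => ?_) hκ
    by_cases hh : r < ‖h‖
    · have hh0 : 0 < ‖h‖ := by linarith
      rw [hg, indicator_of_mem (by exact hh), indicator_of_mem (by exact hr.trans_lt hh), kern,
        kern, ← ENNReal.ofReal_mul (by positivity)]
      apply ENNReal.ofReal_le_ofReal
      calc r ^ s * ‖h‖ ^ (-((n : ℝ) + 2 * s)) ≤ ‖h‖ ^ s * ‖h‖ ^ (-((n : ℝ) + 2 * s)) := by gcongr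
        _ = _ := by
          rw [← Real.rpow_add hh0]
          congr 1
          ring
    · rw [hg, indicator_of_notMem (by exact hh)]
      simp
  obtain ⟨hi, hle⟩ := integral_mul_longQuot_sq_le v hgm hg0 hκ0 hgκ
  have hE := integrable_longQuot_sq v
  have hE0 : 0 ≤ ∫ p, longQuot s (field v) p ^ 2 := integral_nonneg fun p => sq_nonneg _
  have hrs : 0 < r ^ s := by positivity
  have hmono : ∫ p : Eu n × Eu n, ((lam - Lam * r ^ α) * longQuot s (field v) p ^ 2 -
      (lam + 1 / lam) / r ^ s * (g (p.2 - p.1) * longQuot s (field v) p ^ 2)) ≤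
      ∫ p : Eu n × Eu n,
      A p.1 p.2 * (longQuot s (field v) p * longQuot s (field v) p) := by
    refine integral_mono_ae ((hE.const_mul _).sub (hi.const_mul _))
      (hA.integrable_form hα hlam v v) ?_
    filter_upwards [hA.ae_abs_le hlam] with p hp
    have h3 : lam - Lam * r ^ α - (lam + 1 / lam) / r ^ s * g (p.2 - p.1) ≤ A p.1 p.2 := by
      by_cases hh : r < ‖p.2 - p.1‖
      · rw [hg, indicator_of_mem (by exact hh), div_mul_cancel₀ _ hrs.ne']
        have h1 := neg_abs_le (A p.1 p.2)
        have h2 : 0 < Lam * r ^ α := by positivity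
        linarith
      · rw [hg, indicator_of_notMem (by exact hh)]
        have h1 := hA.sub_le hlam p.1 p.2
        have h2 := Real.rpow_le_rpow (norm_nonneg _) (not_lt.1 hh) hα.le
        nlinarith
    have h4 := mul_le_mul_of_nonneg_right h3 (sq_nonneg (longQuot s (field v) p))
    nlinarith
  rw [integral_sub (hE.const_mul _) (hi.const_mul _), integral_const_mul,
    integral_const_mul] at hmono
  refine le_trans ?_ hmono
  rw [lt_div_iff₀ hLam] at hC
  have h5 : ∫ p : Eu n × Eu n, g (p.2 - p.1) * longQuot s (field v) p ^ 2 ≤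
      4 * κ * K * ∫ p, longQuot s (field v) p ^ 2 := by
    rw [mul_assoc (4 * κ)]
    exact hle.trans (by gcongr)
  have h6 : (lam + 1 / lam) / r ^ s *
      (∫ p : Eu n × Eu n, g (p.2 - p.1) * longQuot s (field v) p ^ 2) ≤
      lam / 4 * ∫ p, longQuot s (field v) p ^ 2 := by
    calc _ ≤ (lam + 1 / lam) / r ^ s * (4 * κ * K * ∫ p, longQuot s (field v) p ^ 2) := by gcongr
      _ = (lam + 1 / lam) * (4 * κ * K) / r ^ s * ∫ p, longQuot s (field v) p ^ 2 := by ring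
      _ ≤ _ := by
        refine mul_le_mul_of_nonneg_right ?_ hE0
        rwa [div_le_iff₀ hrs]
  have h7 := mul_le_mul_of_nonneg_right hC.le hE0
  nlinarith

end CoeffClass

/-- Coercivity on fields vanishing outside `Ω`, with the threshold for `λ / Λ`. -/
theorem exists_coercive_threshold (hn : 1 ≤ n) {Ω : Set (Eu n)} (hΩ : Bornology.IsBounded Ω)
    {α : ℝ} (hα : α ∈ Ioo (0 : ℝ) 1) (hs : s ∈ Ioo (0 : ℝ) 1) :
    ∃ C : ℝ → ℝ, (∀ lam, 0 < C lam) ∧ (α < 2 * s → ∀ lam lam', C lam = C lam') ∧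
      ∀ lam Lam : ℝ, 0 < lam → 0 < Lam → C lam < lam / Lam →
        ∀ A : Eu n → Eu n → ℝ, CoeffClass α lam Lam A → ∃ c : ℝ, 0 < c ∧
          ∀ v ∈ vanishingOutside s Ω,
            c * ((∫ x, ‖field v x‖ ^ 2) + ∫ p, ‖diffQuot s (field v) p‖ ^ 2) ≤
              pairing s A (field v) (field v) := by
  obtain ⟨hα0, hα1⟩ := hα
  obtain ⟨hs0, hs1⟩ := hs
  obtain ⟨K, hK0, hK⟩ := exists_korn_poincare hn ⟨hs0, hs1⟩ hΩ
  have hend : ∀ {lam Lam : ℝ} {A : Eu n → Eu n → ℝ}, 0 < lam → CoeffClass α lam Lam A →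
      (∀ v ∈ vanishingOutside s Ω, lam / 2 * ∫ p, longQuot s (field v) p ^ 2 ≤
        ∫ p : Eu n × Eu n, A p.1 p.2 * (longQuot s (field v) p * longQuot s (field v) p)) →
      ∃ c : ℝ, 0 < c ∧ ∀ v ∈ vanishingOutside s Ω,
            c * ((∫ x, ‖field v x‖ ^ 2) + ∫ p, ‖diffQuot s (field v) p‖ ^ 2) ≤
              pairing s A (field v) (field v) := by
    intro lam Lam A hlam hA h
    refine ⟨lam / 4 / K, by positivity, fun v hv => ?_⟩
    rw [hA.pairing_eq hα0 hlam]
    refine le_trans ?_ (h v hv)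
    obtain ⟨h1, h2⟩ := hK v hv
    calc _ ≤ lam / 4 / K * (2 * (K * ∫ p, longQuot s (field v) p ^ 2)) := by
          gcongr
          linarith
      _ = _ := by
          field_simp
          norm_num
  by_cases hαs : α < 2 * s
  · have hfin := lintegral_kern_compl_ball_ne_top hn (t := n + 2 * s - α) (by linarith)
      (by linarith)
    set κ := (∫⁻ h : Eu n, {h | 1 < ‖h‖}.indicator (kern (n + 2 * s - α)) h).toReal
    have hκ0 : 0 ≤ κ := ENNReal.toReal_nonneg
    refine ⟨fun _ => 2 * (1 + 4 * κ * K), fun _ => by positivity, fun _ _ _ => rfl, ?_⟩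
    intro lam Lam hlam hLam hC A hA
    exact hend hlam hA fun v hv => hA.le_integral_of_lt_two_mul hα0 hlam hLam hκ0
      (ENNReal.ofReal_toReal hfin).ge hC (hK v hv).1
  · have hfin := lintegral_kern_compl_ball_ne_top hn (t := n + s) (by linarith) (by linarith)
    set κ := (∫⁻ h : Eu n, {h | 1 < ‖h‖}.indicator (kern (n + s)) h).toReal
    have hκ0 : 0 ≤ κ := ENNReal.toReal_nonneg
    -- `b lam = r ^ s` for the cut radius `r`: it makes the far part at most `λ/4` of the energy
    set b : ℝ → ℝ := fun lam => 1 + 4 * (1 + 1 / lam ^ 2) * (4 * κ * K) with hb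
    have hb1 : ∀ lam, 1 ≤ b lam := fun lam => by
      have : 0 ≤ 4 * (1 + 1 / lam ^ 2) * (4 * κ * K) := by positivity
      linarith
    refine ⟨fun lam => 4 * (b lam ^ s⁻¹) ^ α, fun lam => ?_, fun h => absurd h hαs, ?_⟩
    · have := hb1 lam
      positivity
    intro lam Lam hlam hLam hC A hA
    have hb0 : 0 ≤ b lam := by linarith [hb1 lam]
    refine hend hlam hA fun v hv => hA.le_integral_of_cut hα0 hs0 hlam hLam hκ0
      (Real.one_le_rpow (hb1 lam) (by positivity)) (ENNReal.ofReal_toReal hfin).ge ?_ hC (hK v hv).1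
    rw [Real.rpow_inv_rpow hb0 hs0.ne']
    have : lam / 4 * b lam = lam / 4 + (lam + 1 / lam) * (4 * κ * K) := by
      rw [hb]
      field_simp
    rw [this]
    linarith

/-! ### The Hilbert space and existence -/

theorem diffQuot_add_ae (u v : Sobolev n s) :
    diffQuot s (field (u + v)) =ᵐ[volume] diffQuot s (field u) + diffQuot s (field v) := by
  refine (diffQuot_congr_ae s (Lp.coeFn_add (u : Lp (Eu n) 2 (volume : Measure (Eu n))) v)).trans
    (.of_forall fun p => ?_)
  simp only [diffQuot, field, Pi.add_apply, ← smul_add]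
  congr 1
  abel

theorem diffQuot_smul_ae (c : ℝ) (u : Sobolev n s) :
    diffQuot s (field (c • u)) =ᵐ[volume] c • diffQuot s (field u) := by
  refine (diffQuot_congr_ae s (Lp.coeFn_smul c (u : Lp (Eu n) 2 (volume : Measure (Eu n))))).trans
    (.of_forall fun p => ?_)
  simp only [diffQuot, field, Pi.smul_apply, ← smul_sub]
  rw [smul_comm]

theorem longQuot_add_ae (u v : Sobolev n s) :
    longQuot s (field (u + v)) =ᵐ[volume] longQuot s (field u) + longQuot s (field v) := by
  filter_upwards [diffQuot_add_ae u v] with p hp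
  simp only [longQuot, hp, Pi.add_apply, inner_add_left]

theorem longQuot_smul_ae (c : ℝ) (u : Sobolev n s) :
    longQuot s (field (c • u)) =ᵐ[volume] c • longQuot s (field u) := by
  filter_upwards [diffQuot_smul_ae c u] with p hp
  simp only [longQuot, hp, Pi.smul_apply, real_inner_smul_left, smul_eq_mul]

/-- The isometric embedding `v ↦ (v, diffQuot s v)` of `Hˢ(ℝⁿ, ℝⁿ)`, with its own norm, into
`L²(ℝⁿ) × L²(ℝⁿ × ℝⁿ)`. It carries the Hilbert structure of `Hˢ`, since `Sobolev n s` as a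
subspace of `L²` has the weaker `L²` norm. -/
noncomputable def graph (n : ℕ) (s : ℝ) : Sobolev n s →ₗ[ℝ]
    WithLp 2 (Lp (Eu n) 2 (volume : Measure (Eu n)) ×
      Lp (Eu n) 2 (volume : Measure (Eu n × Eu n))) where
  toFun v := WithLp.toLp 2 (v, (memLp_diffQuot_field v).toLp _)
  map_add' u v := by
    rw [← WithLp.toLp_add, Prod.mk_add_mk, ← MemLp.toLp_add]
    congr 2
    exact (MemLp.toLp_eq_toLp_iff _ _).2 (diffQuot_add_ae u v)
  map_smul' c u := by
    rw [RingHom.id_apply, ← WithLp.toLp_smul, Prod.smul_mk, ← MemLp.toLp_const_smul]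
    congr 2
    exact (MemLp.toLp_eq_toLp_iff _ _).2 (diffQuot_smul_ae c u)

theorem graph_injective : Function.Injective (graph n s) := fun _ _ h =>
  Subtype.ext (congrArg WithLp.fst h)

theorem L2_norm_sq_eq_integral {X : Type*} [MeasurableSpace X] {μ : Measure X} {f : X → Eu n}
    (hf : MemLp f 2 μ) : ‖hf.toLp f‖ ^ 2 = ∫ x, ‖f x‖ ^ 2 ∂μ := by
  rw [← real_inner_self_eq_norm_sq, L2.inner_def]
  refine integral_congr_ae ?_
  filter_upwards [hf.coeFn_toLp] with x hx
  rw [hx, real_inner_self_eq_norm_sq]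

theorem norm_graph_sq (v : Sobolev n s) :
    ‖graph n s v‖ ^ 2 = (∫ x, ‖field v x‖ ^ 2) + ∫ p, ‖diffQuot s (field v) p‖ ^ 2 := by
  rw [WithLp.prod_norm_sq_eq_of_L2]
  congr 1
  · have h := L2_norm_sq_eq_integral (Lp.memLp (v : Lp (Eu n) 2 (volume : Measure (Eu n))))
    rwa [Lp.toLp_coeFn] at h
  · exact L2_norm_sq_eq_integral (memLp_diffQuot_field v)

theorem norm_graph (v : Sobolev n s) : ‖graph n s v‖ = sobolevNorm v := by
  rw [sobolevNorm, ← norm_graph_sq, Real.sqrt_sq (norm_nonneg _)]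

/-- The fields of `Hˢ(ℝⁿ, ℝⁿ)` that vanish outside `Ω`, as a subspace. -/
def vanishingSubmodule (s : ℝ) (Ω : Set (Eu n)) : Submodule ℝ (Sobolev n s) where
  carrier := vanishingOutside s Ω
  zero_mem' := by
    filter_upwards [Lp.coeFn_zero (Eu n) 2 (volume : Measure (Eu n))] with x hx _
    exact hx
  add_mem' := by
    intro u v hu hv
    filter_upwards [hu, hv, Lp.coeFn_add (u : Lp (Eu n) 2 (volume : Measure (Eu n))) v]
      with x h1 h2 h3 hx
    have h4 : field (u + v) x = field u x + field v x := h3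
    rw [h4, h1 hx, h2 hx, add_zero]
  smul_mem' := by
    intro c u hu
    filter_upwards [hu, Lp.coeFn_smul c (u : Lp (Eu n) 2 (volume : Measure (Eu n)))]
      with x h1 h3 hx
    have h4 : field (c • u) x = c • field u x := h3
    rw [h4, h1 hx, smul_zero]

open Filter Topology in
/-- The fields vanishing outside `Ω` form a complete subspace of `Hˢ(ℝⁿ, ℝⁿ)`: along a
subsequence, `v` and its difference quotients converge almost everywhere. -/
theorem isClosed_range_graph (Ω : Set (Eu n)) :
    IsClosed (range ((graph n s).domRestrict (vanishingSubmodule s Ω))) := by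
  refine IsSeqClosed.isClosed fun z w hz hzw => ?_
  choose v hv using hz
  have h1 : Tendsto (fun k => ((v k : Sobolev n s) : Lp (Eu n) 2 (volume : Measure (Eu n))))
      atTop (𝓝 w.fst) := by
    have := ((WithLp.continuous_fst 2 _ _).tendsto w).comp hzw
    refine this.congr fun k => ?_
    rw [Function.comp_apply, ← hv k]
    rfl
  have h2 : Tendsto (fun k => (memLp_diffQuot_field (v k : Sobolev n s)).toLp _)
      atTop (𝓝 w.snd) := by
    have := ((WithLp.continuous_snd 2 _ _).tendsto w).comp hzw
    refine this.congr fun k => ?_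
    rw [Function.comp_apply, ← hv k]
    rfl
  obtain ⟨a, ha, hae⟩ := (tendstoInMeasure_of_tendsto_Lp h1).exists_seq_tendsto_ae
  obtain ⟨b, hb, hbe⟩ :=
    (tendstoInMeasure_of_tendsto_Lp (h2.comp ha.tendsto_atTop)).exists_seq_tendsto_ae
  have hfst := (Measure.quasiMeasurePreserving_fst
    (μ := (volume : Measure (Eu n))) (ν := (volume : Measure (Eu n)))).ae hae
  have hsnd := (Measure.quasiMeasurePreserving_snd
    (μ := (volume : Measure (Eu n))) (ν := (volume : Measure (Eu n)))).ae hae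
  have hcoe : ∀ᵐ p, ∀ k, (memLp_diffQuot_field (v k : Sobolev n s)).toLp _ p =
      diffQuot s (field (v k : Sobolev n s)) p :=
    ae_all_iff.2 fun k => (memLp_diffQuot_field (v k : Sobolev n s)).coeFn_toLp
  have hlim : diffQuot s w.fst =ᵐ[volume] w.snd := by
    filter_upwards [hfst, hsnd, hcoe, hbe] with p h3 h4 h5 h6
    have h7 : Tendsto (fun k => diffQuot s (field (v (a (b k)) : Sobolev n s)) p) atTop
        (𝓝 (diffQuot s w.fst p)) :=
      (((h4.sub h3).const_smul _).comp hb.tendsto_atTop)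
    refine tendsto_nhds_unique h7 (h6.congr fun k => ?_)
    exact h5 (a (b k))
  have hmem : w.fst ∈ Sobolev n s := (memLp_congr_ae hlim).2 (Lp.memLp w.snd)
  have hvan : (⟨w.fst, hmem⟩ : Sobolev n s) ∈ vanishingSubmodule s Ω := by
    have hall : ∀ᵐ x, ∀ k, x ∉ Ω → field (v k : Sobolev n s) x = 0 :=
      ae_all_iff.2 fun k => (v k).2
    filter_upwards [hae, hall] with x h3 h4 hx
    refine tendsto_nhds_unique h3 ?_
    exact tendsto_const_nhds.congr fun k => (h4 (a k) hx).symm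
  refine ⟨⟨⟨w.fst, hmem⟩, hvan⟩, ?_⟩
  have h8 : (memLp_diffQuot_field (⟨w.fst, hmem⟩ : Sobolev n s)).toLp _ = w.snd :=
    Lp.ext ((MemLp.coeFn_toLp _).trans hlim)
  change WithLp.toLp 2 (w.fst, (memLp_diffQuot_field (⟨w.fst, hmem⟩ : Sobolev n s)).toLp _) = w
  rw [h8]
  rfl

/-- The Lax–Milgram theorem for a symmetric form on a vector space that is embedded with closed
range into a Hilbert space. -/
theorem exists_eq_of_coercive {X H : Type*} [AddCommGroup X] [Module ℝ X]
    [NormedAddCommGroup H] [InnerProductSpace ℝ H] [CompleteSpace H] (ι : X →ₗ[ℝ] H)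
    (hι : Function.Injective ι) (hcl : IsClosed (range ι)) (B : LinearMap.BilinForm ℝ X)
    (hB : B.IsSymm) {c M D : ℝ} (hc : 0 < c) (hcB : ∀ x, c * ‖ι x‖ ^ 2 ≤ B x x) (hM : 0 ≤ M)
    (hMB : ∀ x, B x x ≤ M * ‖ι x‖ ^ 2) (F : X →ₗ[ℝ] ℝ) (hF : ∀ x, |F x| ≤ D * ‖ι x‖) :
    ∃ x, ∀ y, B x y = F y := by
  set e := LinearEquiv.ofInjective ι hι with he
  have hcomp : CompleteSpace (LinearMap.range ι) := by
    have : IsClosed ((LinearMap.range ι : Submodule ℝ H) : Set H) := by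
      rwa [LinearMap.coe_range]
    exact this.completeSpace_coe
  have hnorm : ∀ z, ‖ι (e.symm z)‖ = ‖z‖ := fun z => by
    have : ι (e.symm z) = (e (e.symm z) : H) := rfl
    rw [this, e.apply_symm_apply]
    rfl
  have hpos : ∀ x, 0 ≤ B x x := fun x => le_trans (by positivity) (hcB x)
  have hbound : ∀ x y, ‖B x y‖ ≤ M * ‖ι x‖ * ‖ι y‖ := by
    intro x y
    refine abs_le_of_sq_le_sq ?_ (by positivity)
    calc B x y ^ 2 ≤ B x x * B y y := LinearMap.BilinForm.apply_sq_le_of_symm B hpos ⟨hB.eq⟩ x y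
      _ ≤ (M * ‖ι x‖ ^ 2) * (M * ‖ι y‖ ^ 2) :=
        mul_le_mul (hMB x) (hMB y) (hpos y) (by positivity)
      _ = _ := by ring
  set B' : LinearMap.range ι →L[ℝ] LinearMap.range ι →L[ℝ] ℝ := LinearMap.mkContinuous₂
    (B.compl₁₂ e.symm.toLinearMap e.symm.toLinearMap) M (fun z w => by
      have := hbound (e.symm z) (e.symm w)
      rw [hnorm, hnorm] at this
      exact this) with hB'
  have hB'apply : ∀ z w, B' z w = B (e.symm z) (e.symm w) := fun z w => rfl
  have hco : IsCoercive B' := by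
    refine ⟨c, hc, fun z => ?_⟩
    rw [hB'apply]
    have := hcB (e.symm z)
    rw [hnorm] at this
    linarith
  set F' : LinearMap.range ι →L[ℝ] ℝ := (F ∘ₗ e.symm.toLinearMap).mkContinuous D (fun z => by
      have := hF (e.symm z)
      rw [hnorm] at this
      exact this) with hF'
  refine ⟨e.symm (hco.continuousLinearEquivOfBilin.symm
    ((InnerProductSpace.toDual ℝ (LinearMap.range ι)).symm F')), fun y => ?_⟩
  have h1 := hco.continuousLinearEquivOfBilin_apply (hco.continuousLinearEquivOfBilin.symm
    ((InnerProductSpace.toDual ℝ (LinearMap.range ι)).symm F')) (e y)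
  rw [ContinuousLinearEquiv.apply_symm_apply, InnerProductSpace.toDual_symm_apply, hB'apply,
    e.symm_apply_apply] at h1
  rw [← h1]
  change F (e.symm (e y)) = F y
  rw [e.symm_apply_apply]

namespace CoeffClass

variable {α lam Lam : ℝ} {A : Eu n → Eu n → ℝ}

/-- The pairing `⟨ℒˢ_A u, v⟩` as a bilinear form on `Hˢ(ℝⁿ, ℝⁿ)`. -/
noncomputable def form (hA : CoeffClass α lam Lam A) (hα : 0 < α) (hlam : 0 < lam) (s : ℝ) :
    LinearMap.BilinForm ℝ (Sobolev n s) :=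
  LinearMap.mk₂ ℝ (fun u v => pairing s A (field u) (field v))
    (fun u v w => by
      rw [hA.pairing_eq hα hlam, hA.pairing_eq hα hlam, hA.pairing_eq hα hlam,
        ← integral_add (hA.integrable_form hα hlam u w) (hA.integrable_form hα hlam v w)]
      refine integral_congr_ae ?_
      filter_upwards [longQuot_add_ae u v] with p hp
      rw [hp, Pi.add_apply]
      ring)
    (fun c u w => by
      rw [hA.pairing_eq hα hlam, hA.pairing_eq hα hlam, smul_eq_mul, ← integral_const_mul]
      refine integral_congr_ae ?_
      filter_upwards [longQuot_smul_ae c u] with p hp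
      rw [hp, Pi.smul_apply, smul_eq_mul]
      ring)
    (fun u v w => by
      rw [hA.pairing_eq hα hlam, hA.pairing_eq hα hlam, hA.pairing_eq hα hlam,
        ← integral_add (hA.integrable_form hα hlam u v) (hA.integrable_form hα hlam u w)]
      refine integral_congr_ae ?_
      filter_upwards [longQuot_add_ae v w] with p hp
      rw [hp, Pi.add_apply]
      ring)
    (fun c u w => by
      rw [hA.pairing_eq hα hlam, hA.pairing_eq hα hlam, smul_eq_mul, ← integral_const_mul]
      refine integral_congr_ae ?_
      filter_upwards [longQuot_smul_ae c w] with p hp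
      rw [hp, Pi.smul_apply, smul_eq_mul]
      ring)

theorem form_isSymm (hA : CoeffClass α lam Lam A) (hα : 0 < α) (hlam : 0 < lam) :
    (hA.form hα hlam s).IsSymm := by
  refine ⟨fun u v => ?_⟩
  change pairing s A (field u) (field v) = pairing s A (field v) (field u)
  rw [hA.pairing_eq hα hlam, hA.pairing_eq hα hlam]
  simp_rw [mul_comm (longQuot s (field u) _)]

/-- Boundedness on the diagonal, which for a symmetric nonnegative form gives continuity. -/
theorem form_self_le (hA : CoeffClass α lam Lam A) (hα : 0 < α) (hlam : 0 < lam)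
    (v : Sobolev n s) : hA.form hα hlam s v v ≤ 1 / lam * ‖graph n s v‖ ^ 2 := by
  have h1 : hA.form hα hlam s v v ≤ 1 / lam * ∫ p, ‖diffQuot s (field v) p‖ ^ 2 := by
    change pairing s A (field v) (field v) ≤ _
    rw [hA.pairing_eq hα hlam, ← integral_const_mul]
    refine integral_mono_ae (hA.integrable_form hα hlam v v)
      ((integrable_norm_sq_diffQuot v).const_mul _) ?_
    filter_upwards [hA.ae_abs_le hlam] with p hp
    have h2 := longQuot_sq_le s (field v) p
    rw [← sq]
    exact (mul_le_mul_of_nonneg_right ((le_abs_self _).trans hp) (sq_nonneg _)).trans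
      (mul_le_mul_of_nonneg_left h2 (by positivity))
  refine h1.trans ?_
  rw [norm_graph_sq]
  have h3 : 0 ≤ ∫ x, ‖field v x‖ ^ 2 := integral_nonneg fun x => sq_nonneg _
  gcongr
  linarith

end CoeffClass

theorem field_ofTest_ae (hs : s ∈ Ioo (0 : ℝ) 1) {φ : Eu n → Eu n} (hφ : ContDiff ℝ ∞ φ)
    (hc : HasCompactSupport φ) : field (Sobolev.ofTest hs φ hφ hc) =ᵐ[volume] φ :=
  MemLp.coeFn_toLp (hφ.continuous.memLp_of_hasCompactSupport hc)

theorem ofTest_mem_vanishingOutside (hs : s ∈ Ioo (0 : ℝ) 1) {Ω : Set (Eu n)} {φ : Eu n → Eu n}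
    (hφ : ContDiff ℝ ∞ φ) (hc : HasCompactSupport φ) (hφΩ : tsupport φ ⊆ Ω) :
    Sobolev.ofTest hs φ hφ hc ∈ vanishingOutside s Ω := by
  filter_upwards [field_ofTest_ae hs hφ hc] with x hx hxΩ
  rw [hx]
  exact image_eq_zero_of_notMem_tsupport fun h => hxΩ (hφΩ h)

theorem pairing_congr_ae_right (A : Eu n → Eu n → ℝ) (u : Eu n → Eu n) {v w : Eu n → Eu n}
    (h : v =ᵐ[volume] w) : pairing s A u v = pairing s A u w := by
  refine integral_congr_ae ?_
  filter_upwards [h] with x hx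
  refine integral_congr_ae ?_
  filter_upwards [h] with y hy
  rw [hx, hy]

end Peridynamic

theorem mainTheorem7 (n : ℕ) (hn : 1 ≤ n)
    (Ω : Set (Peridynamic.Eu n)) (hΩo : IsOpen Ω) (hΩb : Bornology.IsBounded Ω)
    (hΩL : Peridynamic.HasLipschitzBoundary Ω)
    (α : ℝ) (hα : α ∈ Set.Ioo (0 : ℝ) 1) (s : ℝ) (hs : s ∈ Set.Ioo (0 : ℝ) 1) :
    ∃ C : ℝ → ℝ, (∀ lam, 0 < C lam) ∧
      (α < 2 * s → ∀ lam lam', C lam = C lam') ∧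
      ∀ lam Lam : ℝ, 0 < lam → 0 < Lam → C lam < lam / Lam →
        ∀ A : Peridynamic.Eu n → Peridynamic.Eu n → ℝ, Peridynamic.CoeffClass α lam Lam A →
          ∀ f : Peridynamic.NegSobolev n s,
            ∃ u ∈ Peridynamic.vanishingOutside s Ω,
              Peridynamic.IsSolution hs Ω A f u ∧
              IsMinOn (Peridynamic.energy A f) (Peridynamic.vanishingOutside s Ω) u := by
  obtain ⟨C, hC0, hCα, hC⟩ := Peridynamic.exists_coercive_threshold hn hΩb hα hs
  refine ⟨C, hC0, hCα, fun lam Lam hlam hLam hlt A hA f => ?_⟩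
  obtain ⟨c, hc, hcv⟩ := hC lam Lam hlam hLam hlt A hA
  set V := Peridynamic.vanishingSubmodule s Ω with hV
  set B := hA.form hα.1 hlam s with hB
  have hBsymm := hA.form_isSymm (s := s) hα.1 hlam
  have hBV : (B.restrict V).IsSymm := ⟨fun u v => hBsymm.eq u v⟩
  obtain ⟨D, hD⟩ := f.2
  -- Lax–Milgram on `V`, whose Hilbert structure comes from the embedding `graph`
  obtain ⟨u, hu⟩ := Peridynamic.exists_eq_of_coercive ((Peridynamic.graph n s).domRestrict V)
    (fun a b h => Subtype.ext (Peridynamic.graph_injective h))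
    (Peridynamic.isClosed_range_graph Ω) (B.restrict V) hBV hc
    (fun v => (congrArg (c * ·) (Peridynamic.norm_graph_sq v.1)).trans_le (hcv v.1 v.2))
    (one_div_pos.2 hlam).le (fun v => hA.form_self_le hα.1 hlam v.1) (f.1.domRestrict V)
    (fun v => (hD v.1).trans_eq (congrArg (D * ·) (Peridynamic.norm_graph v.1).symm))
  have hu' : ∀ v ∈ Peridynamic.vanishingOutside s Ω, B u v = f.1 v := fun v hv => hu ⟨v, hv⟩
  refine ⟨u, u.2, fun φ hφ hφc hφΩ => ?_, fun v hv => ?_⟩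
  · rw [← hu' _ (Peridynamic.ofTest_mem_vanishingOutside hs hφ hφc hφΩ)]
    exact Peridynamic.pairing_congr_ae_right A _ (Peridynamic.field_ofTest_ae hs hφ hφc).symm
  · -- the energy gap is `½ ⟨ℒˢ_A (v - u), v - u⟩`, which coercivity makes nonnegative
    have hpos : 0 ≤ B (v - u) (v - u) :=
      le_trans (by positivity) (hcv (v - u) (V.sub_mem hv u.2))
    have h1 := hu' v hv
    have h2 := hu' u u.2
    have h3 : B v u = B u v := hBsymm.eq v u
    simp only [map_sub, LinearMap.sub_apply] at hpos
    change 1 / 2 * B u u - f.1 u ≤ 1 / 2 * B v v - f.1 v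
    linarith
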